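/- **Setting.** Let $d\ge 2$, let $\mathcal S=\mathcal C^\infty(\mathbb S^{d-1})$ (complex-valued) carry the topology of the norms $\|(\mathrm{Id}-\Delta_{\mathbb S^{d-1}})^n h\|_\infty$, $n\in\mathbb N$, and let $\mathcal S'$ be its topological dual; a function $g$ is identified with the functional $h\mapsto\int g\,h$. Let $\mathrm{Harm}_n=\{Y\in\mathcal S:\Delta_{\mathbb S^{d-1}}Y=-n(n+d-2)Y\}$, $N_d(n)=\dim \mathrm{Harm}_n$, and let $(Y_n^m)_{m}$ be an orthonormal basis of $\mathrm{Harm}_n$ for the inner product $\langle f,g\rangle=\int f\bar g$. A *spherical pseudo-differential operator* is a linear operator $\mathcal D:\mathcal S\to\mathcal S$ of the form $\mathcal Dh=\sum_n\hat D_n\sum_m\langle h,Y_n^m\rangle Y_n^m$ (convergence in $\mathcal L^2$), where $\hat D_n\in\mathbb R$ vanishes for at most finitely many $n$ and $|\hat D_n|=\Theta(n^p)$ for some $p\ge0$. It acts on $\mathcal S'$ by $\langle\mathcal Df|h\rangle=\langle f|\mathcal Dh\rangle$. It is *positive-definite* if $\langle\mathcal Dh,h\rangle>0$ for all $0\ne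 h\in\mathcal S$. Its *zonal Green kernel* is $\psi_{\mathcal D}(t)=\sum_{n:\hat D_n\neq0}\frac{N_d(n)}{a_d\hat D_n}P_{n,d}(t)$, with $a_d$ the area of $\mathbb S^{d-1}$ and $P_{n,d}$ the $d$-dimensional ultraspherical polynomial normalised by $P_{n,d}(1)=1$; $\mathcal D$ is *spline-admissible* if $\psi_{\mathcal D}(\langle\mathbf r,\mathbf s\rangle)$ is defined (the series converges) for all $\mathbf r,\mathbf s\in\mathbb S^{d-1}$. For $u\in\mathcal S'$ let $\|u\|_{TV}=\sup\{|\langle u|h\rangle|:h\in\mathcal S,\|h\|_\infty=1\}$, let $\mathcal M=\{u\in\mathcal S':\|u\|_{TV}<\infty\}$, $\mathcal M_{\mathcal D}=\{f\in\mathcal S':\mathcal Df\in\mathcal M\}$ and $\mathcal C_{\mathcal D}=\{\varphi\in\mathcal S':\varphi=\mathcal D\eta,\ \eta\in\mathcal C(\mathbb S^{d-1})\}$. For $f\in\mathcal M_{\mathcal D}$ and $\varphi=\mathcal D\eta\in\mathcal C_{\mathcal D}$ the duality product is $\langle f|\varphi\rangle=\langle\mathcal Df|\eta\rangle$, the measure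 $\mathcal Df$ being extended continuously to $(\mathcal C(\mathbb S^{d-1}),\|\cdot\|_\infty)$. **Theorem 3 (Canonical discretisation of FPBP problems).** Let $\mathcal D$ be a spline-admissible, positive-definite spherical pseudo-differential operator (in particular it has trivial nullspace). Let $\varphi_1,\dots,\varphi_L\in\mathcal C_{\mathcal D}$ be linearly independent, and $\Phi f=(\langle f|\varphi_1\rangle,\dots,\langle f|\varphi_L\rangle)$ for $f\in\mathcal M_{\mathcal D}$. Let $F:\mathbb C^L\times\mathbb C^L\to[0,+\infty]$ be such that $F(\mathbf y,\cdot)$ is proper, convex and lower semi-continuous for every $\mathbf y$, and let $\lambda>0$. Let $\mathbf r_1,\dots,\mathbf r_N\in\mathbb S^{d-1}$ be distinct, and let $\psi_n=\psi_{\mathcal D}(\langle\cdot,\mathbf r_n\rangle)$, $\mathfrak S=\operatorname{span}\{\psi_1,\dots,\psi_N\}$ and $\Psi:\mathbb C^N\to\mathfrak S$, $\Psi\mathbf x=\sum_n x_n\psi_n$. Then each $\psi_n$ is in $\mathcal L^2(\mathbb S^{d-1})$, $\mathfrak S$ is the space $\{s\in\mathcal S':\mathcal Ds=\sum_n\alpha_n\delta_{\mathbf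 r_n},\ \alpha\in\mathbb C^N\}$ of $\mathcal D$-splines with knots $\mathbf r_1,\dots,\mathbf r_N$, and $\mathfrak S\subset\mathcal M_{\mathcal D}$. Let $G\in\mathbb C^{L\times N}$ be the matrix $G_{ln}=\langle\psi_{\mathcal D}(\langle\cdot,\mathbf r_n\rangle)|\varphi_l\rangle$. Then: 1. for each $\mathbf y\in\mathbb C^L$ the restricted FPBP problem and the discrete PBP problem $$\mathcal V=\operatorname*{Arg\,min}_{f\in\mathfrak S}\{F(\mathbf y,\Phi f)+\lambda\|\mathcal Df\|_{TV}\},\qquad \mathfrak U=\operatorname*{Arg\,min}_{\mathbf x\in\mathbb C^N}\{F(\mathbf y,G\mathbf x)+\lambda\|\mathbf x\|_1\}$$ are equivalent: $\Psi$ maps $\mathfrak U$ bijectively onto $\mathcal V$, so $\mathcal V=\Psi(\mathfrak U)$, and $\mathfrak U=\Psi^\dagger(\mathcal V)$, where $\Psi^\dagger:\mathfrak S\to\mathbb C^N$ is the Moore-Penrose pseudo-inverse of $\Psi$ (with the $\mathcal L^2$ inner product on $\mathfrak S$); 2. $\Phi\Psi\mathbf x=G\mathbf x$ for all $\mathbf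 x\in\mathbb C^N$; 3. if $\varphi_l\in\mathcal L^2(\mathbb S^{d-1})$, then $G_{ln}=(\psi_{\mathcal D}*\varphi_l)(\mathbf r_n)=\int_{\mathbb S^{d-1}}\psi_{\mathcal D}(\langle\mathbf r_n,\mathbf s\rangle)\varphi_l(\mathbf s)\,d\mathbf s$ for all $n$. -/

import Mathlib

open MeasureTheory Filter Topology Metric
open scoped Manifold ContDiff ENNReal NNReal ComplexConjugate

namespace SphereSpline

noncomputable section

/-! ### The hypersphere, smooth functions, the Laplace-Beltrami operator -/

/-- Euclidean space `ℝ^d`. -/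
abbrev Amb (d : ℕ) : Type := EuclideanSpace ℝ (Fin d)

/-- The unit hypersphere `𝕊^{d-1}` of `ℝ^d`. -/
abbrev Sph (d : ℕ) : Type := sphere (0 : Amb d) 1

/-- The surface measure of `𝕊^{d-1}`. -/
abbrev surf (d : ℕ) : Measure (Sph d) := (volume : Measure (Amb d)).toSphere

instance factFinrank (d : ℕ) [hd : Fact (2 ≤ d)] :
    Fact (Module.finrank ℝ (Amb d) = (d - 1) + 1) :=
  ⟨by have := hd.out; simp [Amb]; omega⟩

/-- Extension of a function on the sphere to `ℝ^d ∖ {0}` that is constant along rays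
(with the irrelevant value `0` at the origin). -/
def radialExt {d : ℕ} (f : Sph d → ℂ) (x : Amb d) : ℂ :=
  if hx : x ≠ 0 then f ⟨‖x‖⁻¹ • x, by simp [norm_smul, hx]⟩ else 0

/-- The Laplace-Beltrami operator of `𝕊^{d-1}`: restriction to the sphere of the Euclidean
Laplacian of the extension that is constant along rays. -/
def lapBel {d : ℕ} (f : Sph d → ℂ) (r : Sph d) : ℂ :=
  Laplacian.laplacian (radialExt f) (r : Amb d)

/-- The space `𝒮(𝕊^{d-1}) = 𝒞^∞(𝕊^{d-1})` of complex-valued Schwartz functions. -/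
def Schw (d : ℕ) [Fact (2 ≤ d)] : Submodule ℂ (Sph d → ℂ) where
  carrier := {f | ContMDiff (𝓡 (d - 1)) 𝓘(ℝ, ℂ) ∞ f}
  add_mem' := fun hf hg => ContMDiff.add hf hg
  zero_mem' := contMDiff_const
  smul_mem' := fun c f hf => by
    have hc : ContDiff ℝ ∞ (fun z : ℂ => c * z) := contDiff_const.mul contDiff_id
    exact hc.contMDiff.comp hf

/-- The supremum norm `‖g‖_∞`, valued in `[0, ∞]`. -/
def supNorm {d : ℕ} (g : Sph d → ℂ) : ℝ≥0∞ := ⨆ r, ‖g r‖ₑ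

/-- The operator `Id - Δ`. -/
def idSubLap {d : ℕ} (g : Sph d → ℂ) : Sph d → ℂ := fun r => g r - lapBel g r

/-- The norms `‖h‖_{n,∞} = ‖(Id - Δ)^n h‖_∞` that generate the topology of `𝒮(𝕊^{d-1})`. -/
def schwNorm {d : ℕ} [Fact (2 ≤ d)] (n : ℕ) (h : Schw d) : ℝ≥0∞ :=
  supNorm (idSubLap^[n] (h : Sph d → ℂ))

section Helpers

theorem radialExt_add {d : ℕ} (f g : Sph d → ℂ) :
    radialExt (f + g) = radialExt f + radialExt g := by
  ext x; by_cases hx : x = 0 <;> simp [radialExt, hx]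

theorem radialExt_smul {d : ℕ} (c : ℂ) (f : Sph d → ℂ) :
    radialExt (c • f) = c • radialExt f := by
  ext x; by_cases hx : x = 0 <;> simp [radialExt, hx]

theorem two_le_infty : (2 : ℕ∞ω) ≤ ((⊤ : ℕ∞) : ℕ∞ω) := ENat.LEInfty.out

theorem sph_coe_ne_zero {d : ℕ} (r : Sph d) : (r : Amb d) ≠ 0 := ne_zero_of_mem_unit_sphere r

theorem integrable_of_continuous {d : ℕ} {g : Sph d → ℂ} (hg : Continuous g) :
    Integrable g (surf d) :=
  hg.integrable_of_hasCompactSupport (HasCompactSupport.of_compactSpace g)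

variable {d : ℕ} [Fact (2 ≤ d)]

theorem schw_contMDiff (h : Schw d) : ContMDiff (𝓡 (d - 1)) 𝓘(ℝ, ℂ) ∞ (h : Sph d → ℂ) := h.2

theorem schw_continuous (h : Schw d) : Continuous (h : Sph d → ℂ) := (schw_contMDiff h).continuous

theorem schw_contDiffAt_radialExt (h : Schw d) {x : Amb d} (hx : x ≠ 0) :
    ContDiffAt ℝ ∞ (radialExt (h : Sph d → ℂ)) x := by
  let U : TopologicalSpace.Opens (Amb d) := ⟨{0}ᶜ, isOpen_compl_singleton⟩
  have hsub : ∀ u : U, (u : Amb d) ≠ 0 := fun u => u.2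
  have h1 : ContMDiff 𝓘(ℝ, Amb d) 𝓘(ℝ, Amb d) ∞ (fun u : U => ‖(u : Amb d)‖⁻¹ • (u : Amb d)) := by
    intro u
    refine (contMDiffAt_subtype_iff (f := fun y : Amb d => ‖y‖⁻¹ • y)).2 ?_
    refine ContDiffAt.contMDiffAt ?_
    exact ((contDiffAt_norm ℝ (hsub u)).inv (norm_ne_zero_iff.2 (hsub u))).smul contDiffAt_id
  have h2 := h1.codRestrict_sphere (n := d - 1)
    (fun u => by simp [norm_smul, hsub u])
  have h3 := (schw_contMDiff h).comp h2
  have h4 := (contMDiffAt_subtype_iff (f := radialExt (h : Sph d → ℂ)) (x := (⟨x, hx⟩ : U))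
    (I := 𝓘(ℝ, Amb d)) (I' := 𝓘(ℝ, ℂ)) (n := ∞)).1 (by
      refine (h3 ⟨x, hx⟩).congr_of_eventuallyEq (Eventually.of_forall fun u => ?_)
      simp only [radialExt, Function.comp]
      rw [dif_pos (hsub u)]
      rfl)
  exact h4.contDiffAt

theorem schw_lapBel_add (f g : Schw d) (r : Sph d) :
    lapBel ((f : Sph d → ℂ) + (g : Sph d → ℂ)) r
      = lapBel (f : Sph d → ℂ) r + lapBel (g : Sph d → ℂ) r := by
  unfold lapBel
  rw [radialExt_add]
  exact ContDiffAt.laplacian_add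
    ((schw_contDiffAt_radialExt f (sph_coe_ne_zero r)).of_le two_le_infty)
    ((schw_contDiffAt_radialExt g (sph_coe_ne_zero r)).of_le two_le_infty)

theorem schw_lapBel_smul (c : ℂ) (f : Schw d) (r : Sph d) :
    lapBel (c • (f : Sph d → ℂ)) r = c * lapBel (f : Sph d → ℂ) r := by
  unfold lapBel
  rw [radialExt_smul]
  have hf : ContDiffAt ℝ 2 (radialExt (f : Sph d → ℂ)) (r : Amb d) :=
    (schw_contDiffAt_radialExt f (sph_coe_ne_zero r)).of_le two_le_infty
  have := hf.laplacian_CLM_comp_left (l := (ContinuousLinearMap.mul ℝ ℂ c))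
  exact this

theorem integrable_L2_mul (g : Lp ℂ 2 (surf d)) (h : Schw d) :
    Integrable (fun s => g s * (h : Sph d → ℂ) s) (surf d) := by
  obtain ⟨C, hC⟩ := isCompact_univ.exists_bound_of_continuousOn (schw_continuous h).continuousOn
  exact ((Lp.memLp g).integrable (by norm_num)).mul_bdd (c := C)
    (schw_continuous h).aestronglyMeasurable (Eventually.of_forall fun x => hC x (Set.mem_univ x))

theorem integrable_cont_mul (η : C(Sph d, ℂ)) (h : Schw d) :
    Integrable (fun s => η s * (h : Sph d → ℂ) s) (surf d) :=
  integrable_of_continuous (η.continuous.mul (schw_continuous h))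

end Helpers

/-! ### Spherical harmonics -/

/-- The eigenspace `Harm_n` of the Laplace-Beltrami operator for the eigenvalue `-n (n + d - 2)`;
its elements are the spherical harmonics of order `n`. -/
def Harm (d : ℕ) [Fact (2 ≤ d)] (n : ℕ) : Submodule ℂ (Schw d) where
  carrier := {Y | ∀ r, lapBel (Y : Sph d → ℂ) r
    = -((n : ℂ) * ((n : ℂ) + (d : ℂ) - 2)) * (Y : Sph d → ℂ) r}
  add_mem' := fun {f g} hf hg r => by
    have := schw_lapBel_add f g r
    simp only [Set.mem_ofPred_eq] at hf hg
    rw [hf r, hg r] at this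
    simp only [Submodule.coe_add, Pi.add_apply]
    rw [this]; ring
  zero_mem' := fun r => by
    have := schw_lapBel_smul (0 : ℂ) (0 : Schw d) r
    simpa using this
  smul_mem' := fun c f hf r => by
    have := schw_lapBel_smul c f r
    simp only [Set.mem_ofPred_eq] at hf
    rw [hf r] at this
    simp only [Submodule.coe_smul, Pi.smul_apply, smul_eq_mul]
    rw [this]; ring

/-- The geometric multiplicity `N_d(n)` of the eigenvalue `-n (n + d - 2)`. -/
def mult (d : ℕ) [Fact (2 ≤ d)] (n : ℕ) : ℕ := Module.finrank ℂ (Harm d n)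

/-- The inner product `⟨f, g⟩ = ∫ f \bar g` of functions on the sphere. -/
def sphInner {d : ℕ} (f g : Sph d → ℂ) : ℂ := ∫ r, f r * conj (g r) ∂(surf d)

/-- `Y` is an orthonormal basis `(Y_n^m)_m` of `Harm_n`. -/
structure IsHarmBasis {d : ℕ} [Fact (2 ≤ d)] (n : ℕ) (Y : Fin (mult d n) → Schw d) : Prop where
  orthonormal : ∀ i j, sphInner (Y i : Sph d → ℂ) (Y j : Sph d → ℂ) = if i = j then 1 else 0
  span_eq : Submodule.span ℂ (Set.range Y) = Harm d n

/-- The `d`-dimensional ultraspherical polynomial `P_{n,d}` of degree `n`, normalised by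
`P_{n,d}(1) = 1`, through its three-term recurrence
`(n + d - 1) P_{n+2}(t) = (2n + d) t P_{n+1}(t) - (n + 1) P_n(t)`
(Legendre polynomials for `d = 3`, Chebyshev polynomials for `d = 2`). -/
def ultraPoly (d : ℕ) : ℕ → ℝ → ℝ
  | 0, _ => 1
  | 1, t => t
  | n + 2, t => ((2 * (n : ℝ) + d) * t * ultraPoly d (n + 1) t - ((n : ℝ) + 1) * ultraPoly d n t)
      / ((n : ℝ) + d - 1)

/-! ### Generalised functions -/

/-- A linear functional on `𝒮(𝕊^{d-1})` is a generalised function, i.e. an element of the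
topological dual `𝒮'(𝕊^{d-1})`, if it is continuous for the topology generated by the norms
`‖·‖_{n,∞}`. -/
def IsGenFun {d : ℕ} [Fact (2 ≤ d)] (u : Module.Dual ℂ (Schw d)) : Prop :=
  ∃ (k : ℕ) (C : ℝ≥0), ∀ h : Schw d,
    ‖u h‖ₑ ≤ C * ∑ j ∈ Finset.range (k + 1), schwNorm j h

/-- The Dirac measure `δ_r` as a functional on `𝒮(𝕊^{d-1})`. -/
def dirac {d : ℕ} [Fact (2 ≤ d)] (r : Sph d) : Module.Dual ℂ (Schw d) where
  toFun h := (h : Sph d → ℂ) r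
  map_add' _ _ := rfl
  map_smul' _ _ := rfl

/-- The embedding of `ℒ²(𝕊^{d-1})` in the generalised functions, `g ↦ (h ↦ ∫ g h)`. -/
def ofL2 {d : ℕ} [Fact (2 ≤ d)] : Lp ℂ 2 (surf d) →ₗ[ℂ] Module.Dual ℂ (Schw d) where
  toFun g :=
    { toFun := fun h => ∫ s, g s * (h : Sph d → ℂ) s ∂(surf d)
      map_add' := fun h k => by
        rw [← integral_add (integrable_L2_mul g h) (integrable_L2_mul g k)]
        simp [mul_add]
      map_smul' := fun c h => by
        simp only [Submodule.coe_smul, Pi.smul_apply, smul_eq_mul, RingHom.id_apply]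
        rw [← integral_const_mul]
        congr 1; ext s; ring }
  map_add' f g := by
    ext h
    simp only [LinearMap.coe_mk, AddHom.coe_mk, LinearMap.add_apply]
    rw [← integral_add (integrable_L2_mul f h) (integrable_L2_mul g h)]
    refine integral_congr_ae ?_
    filter_upwards [Lp.coeFn_add f g] with s hs
    rw [hs]; simp [add_mul]
  map_smul' c g := by
    ext h
    simp only [LinearMap.coe_mk, AddHom.coe_mk, LinearMap.smul_apply, RingHom.id_apply,
      smul_eq_mul]
    rw [← integral_const_mul]
    refine integral_congr_ae ?_
    filter_upwards [Lp.coeFn_smul c g] with s hs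
    rw [hs]; simp [mul_assoc]

/-- The embedding of `𝒞(𝕊^{d-1})` in the generalised functions, `η ↦ (h ↦ ∫ η h)`. -/
def ofCont {d : ℕ} [Fact (2 ≤ d)] (η : C(Sph d, ℂ)) : Module.Dual ℂ (Schw d) where
  toFun h := ∫ s, η s * (h : Sph d → ℂ) s ∂(surf d)
  map_add' h k := by
    rw [← integral_add (integrable_cont_mul η h) (integrable_cont_mul η k)]
    simp [mul_add]
  map_smul' c h := by
    simp only [Submodule.coe_smul, Pi.smul_apply, smul_eq_mul, RingHom.id_apply]
    rw [← integral_const_mul]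
    congr 1; ext s; ring

/-- A Schwartz function as a continuous function. -/
def toCont {d : ℕ} [Fact (2 ≤ d)] (h : Schw d) : C(Sph d, ℂ) := ⟨h, schw_continuous h⟩

/-- The total variation norm `‖u‖_TV = sup {|⟨u|h⟩| : h ∈ 𝒮(𝕊^{d-1}), ‖h‖_∞ = 1}`. -/
def tvNorm {d : ℕ} [Fact (2 ≤ d)] (u : Module.Dual ℂ (Schw d)) : ℝ≥0∞ :=
  ⨆ (h : Schw d) (_ : supNorm (h : Sph d → ℂ) = 1), ‖u h‖ₑ

/-- The space `ℳ(𝕊^{d-1})` of regular Borel measures: the generalised functions of finite total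
variation norm. -/
def measSpace (d : ℕ) [Fact (2 ≤ d)] : Set (Module.Dual ℂ (Schw d)) :=
  {u | IsGenFun u ∧ tvNorm u < ⊤}

/-! ### Spherical pseudo-differential operators -/

/-- A spherical pseudo-differential operator: a linear operator on `𝒮(𝕊^{d-1})` of the form
`D h = ∑_n D̂_n ∑_m ⟨h, Y_n^m⟩ Y_n^m` (convergence in `ℒ²`), where `(Y_n^m)_m` are orthonormal bases
of the spaces `Harm_n`, whose real Fourier symbol `D̂` vanishes at most finitely often and satisfies
`|D̂_n| = Θ(n^p)` for some `p ≥ 0`. -/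
structure PseudoDiffOp (d : ℕ) [Fact (2 ≤ d)] where
  /-- the operator -/
  toLin : Schw d →ₗ[ℂ] Schw d
  /-- the Fourier symbol -/
  symbol : ℕ → ℝ
  expansion : ∀ Y : (n : ℕ) → Fin (mult d n) → Schw d, (∀ n, IsHarmBasis n (Y n)) →
    ∀ h : Schw d, Tendsto (fun K : ℕ => eLpNorm (fun r => (toLin h : Sph d → ℂ) r
      - ∑ n ∈ Finset.range K, (symbol n : ℂ) *
          ∑ m, sphInner (h : Sph d → ℂ) (Y n m : Sph d → ℂ) * (Y n m : Sph d → ℂ) r)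
      2 (surf d)) atTop (𝓝 0)
  finite_zeros : {n | symbol n = 0}.Finite
  growth : ∃ p : ℝ, 0 ≤ p ∧ (fun n => |symbol n|) =Θ[atTop] (fun n : ℕ => (n : ℝ) ^ p)

namespace PseudoDiffOp

variable {d : ℕ} [Fact (2 ≤ d)]

/-- The action of `D` on functionals by duality, `⟨D f | h⟩ = ⟨f | D h⟩`. -/
def ext (D : PseudoDiffOp d) : Module.Dual ℂ (Schw d) →ₗ[ℂ] Module.Dual ℂ (Schw d) :=
  D.toLin.dualMap

/-- `D` is positive-definite: `⟨D h, h⟩ > 0` for all nonzero Schwartz functions `h`. -/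
def PosDef (D : PseudoDiffOp d) : Prop :=
  ∀ h : Schw d, h ≠ 0 → 0 < (sphInner (D.toLin h : Sph d → ℂ) (h : Sph d → ℂ)).re

/-- Partial sums, at `t ∈ [-1, 1]`, of the series `∑_{n : D̂_n ≠ 0} N_d(n) / (a_d D̂_n) P_{n,d}(t)`,
where `a_d` is the area of the sphere. -/
def greenPartial (D : PseudoDiffOp d) (t : ℝ) (K : ℕ) : ℝ :=
  ∑ n ∈ (Finset.range K).filter (fun n => D.symbol n ≠ 0),
    (mult d n : ℝ) / ((surf d).real Set.univ * D.symbol n) * ultraPoly d n t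

/-- The zonal Green kernel `ψ_D`, the sum of the above series. -/
def green (D : PseudoDiffOp d) (t : ℝ) : ℝ := limUnder atTop (D.greenPartial t)

/-- The trace `r ↦ ψ_D(⟨r, s⟩)` of the zonal Green kernel. -/
def trace (D : PseudoDiffOp d) (s r : Sph d) : ℂ := (D.green (inner ℝ (r : Amb d) (s : Amb d)) : ℂ)

/-- `D` is spline-admissible: every trace `ψ_D(⟨·, s⟩)` of the zonal Green kernel is defined at
every point, i.e. the series defining it converges there. -/
def SplineAdmissible (D : PseudoDiffOp d) : Prop :=
  ∀ r s : Sph d, ∃ l : ℝ,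
    Tendsto (D.greenPartial (inner ℝ (r : Amb d) (s : Amb d))) atTop (𝓝 l)

/-- The search space `ℳ_D(𝕊^{d-1})`: generalised functions `f` such that `D f` is a measure. -/
def searchSpace (D : PseudoDiffOp d) : Set (Module.Dual ℂ (Schw d)) :=
  {f | IsGenFun f ∧ D.ext f ∈ measSpace d}

/-- The predual `𝒞_D(𝕊^{d-1})`: generalised functions of the form `D η` with `η` continuous. -/
def predual (D : PseudoDiffOp d) : Set (Module.Dual ℂ (Schw d)) :=
  {φ | IsGenFun φ ∧ ∃ η : C(Sph d, ℂ), φ = D.ext (ofCont η)}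

/-- `z` is the value of the duality product `⟨f | φ⟩` of `f ∈ ℳ_D` and `φ = D η ∈ 𝒞_D`, namely
`⟨D f | η⟩`, where the measure `D f` is extended from `𝒮` to a continuous linear functional `T` on
`(𝒞, ‖·‖_∞)`. -/
def IsDualityValue (D : PseudoDiffOp d) (f φ : Module.Dual ℂ (Schw d)) (z : ℂ) : Prop :=
  ∃ T : C(Sph d, ℂ) →L[ℂ] ℂ, (∀ h : Schw d, T (toCont h) = D.ext f h) ∧
    ∃ η : C(Sph d, ℂ), φ = D.ext (ofCont η) ∧ T η = z

open Classical in
/-- The duality product `⟨· | ·⟩ : ℳ_D × 𝒞_D → ℂ` (set to `0` where it is not defined). -/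
def duality (D : PseudoDiffOp d) (f φ : Module.Dual ℂ (Schw d)) : ℂ :=
  if H : ∃ z, D.IsDualityValue f φ z then H.choose else 0

/-- The sampling operator `Φ f = (⟨f | φ_1⟩, …, ⟨f | φ_L⟩)`. -/
def sampling (D : PseudoDiffOp d) {L : ℕ} (φ : Fin L → Module.Dual ℂ (Schw d))
    (f : Module.Dual ℂ (Schw d)) : Fin L → ℂ := fun l => D.duality f (φ l)

/-- The zonal function `ψ_D(⟨·, s⟩)` as an element of `ℒ²` (set to `0` if it is not
square-integrable). -/
def greenL2 (D : PseudoDiffOp d) (s : Sph d) : Lp ℂ 2 (surf d) :=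
  open Classical in if H : MemLp (D.trace s) 2 (surf d) then H.toLp (D.trace s) else 0

/-- The span of the zonal functions `ψ_n = ψ_D(⟨·, r_n⟩)`, with the `ℒ²` inner product. -/
def splineSpan (D : PseudoDiffOp d) {N : ℕ} (r : Fin N → Sph d) : Submodule ℂ (Lp ℂ 2 (surf d)) :=
  Submodule.span ℂ (Set.range fun n => D.greenL2 (r n))

/-- The generalised functions `s` with `D s = ∑_n α_n δ_{r_n}` for some amplitudes `α`, i.e. the
`D`-splines with knots `r_1, …, r_N`. -/
def splines (D : PseudoDiffOp d) {N : ℕ} (r : Fin N → Sph d) : Set (Module.Dual ℂ (Schw d)) :=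
  {s | IsGenFun s ∧ ∃ α : Fin N → ℂ, D.ext s = ∑ n, α n • dirac (r n)}

/-- The synthesis operator `Ψ x = ∑_n x_n ψ_n`. -/
def synthesis (D : PseudoDiffOp d) {N : ℕ} (r : Fin N → Sph d) :
    EuclideanSpace ℂ (Fin N) →ₗ[ℂ] D.splineSpan r where
  toFun x := ⟨∑ n, x n • D.greenL2 (r n), Submodule.sum_mem _ fun n _ =>
    Submodule.smul_mem _ _ (Submodule.subset_span ⟨n, rfl⟩)⟩
  map_add' x y := by
    ext1
    simp [add_smul, Finset.sum_add_distrib]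
  map_smul' c x := by
    ext1
    simp [mul_smul, Finset.smul_sum]

/-- The matrix `G_{ln} = ⟨ψ_D(⟨·, r_n⟩) | φ_l⟩`. -/
def sensing (D : PseudoDiffOp d) {L N : ℕ} (φ : Fin L → Module.Dual ℂ (Schw d))
    (r : Fin N → Sph d) : Matrix (Fin L) (Fin N) ℂ :=
  Matrix.of fun l n => D.duality (ofL2 (D.greenL2 (r n))) (φ l)

/-- The objective `f ↦ F(y, Φ f) + λ ‖D f‖_TV`; here `Fy = F(y, ·)`. -/
def fpbpCost (D : PseudoDiffOp d) {L : ℕ} (φ : Fin L → Module.Dual ℂ (Schw d))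
    (Fy : (Fin L → ℂ) → ℝ≥0∞) (lam : ℝ) (f : Module.Dual ℂ (Schw d)) : ℝ≥0∞ :=
  Fy (D.sampling φ f) + ENNReal.ofReal lam * tvNorm (D.ext f)

end PseudoDiffOp

/-- The spherical convolution `(ψ * g)(r) = ∫ ψ(⟨r, s⟩) g(s) ds`. -/
def sphConv {d : ℕ} (ψ : ℝ → ℝ) (g : Sph d → ℂ) (r : Sph d) : ℂ :=
  ∫ s, (ψ (inner ℝ (r : Amb d) (s : Amb d)) : ℂ) * g s ∂(surf d)

/-! ### Optimisation -/

/-- The objective `x ↦ F(y, G x) + λ ‖x‖_1`; here `Fy = F(y, ·)`. -/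
def pbpCost {L N : ℕ} (G : Matrix (Fin L) (Fin N) ℂ) (Fy : (Fin L → ℂ) → ℝ≥0∞) (lam : ℝ)
    (x : EuclideanSpace ℂ (Fin N)) : ℝ≥0∞ :=
  Fy (G.mulVec fun n => x n) + ENNReal.ofReal (lam * ∑ n, ‖x n‖)

/-- The set of minimisers of an objective. -/
def argMin {X : Type*} (J : X → ℝ≥0∞) : Set X := {x | ∀ z, J x ≤ J z}

/-- The function `F(y, ·)` is proper, convex and lower semi-continuous. -/
structure IsCost {L : ℕ} (Fy : (Fin L → ℂ) → ℝ≥0∞) : Prop where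
  proper : ∃ z, Fy z ≠ ⊤
  convex : ConvexOn ℝ≥0 Set.univ Fy
  lsc : LowerSemicontinuous Fy

/-- `B` is the Moore-Penrose pseudo-inverse of the linear map `A` between inner product spaces. -/
structure IsMoorePenrose {E F : Type*} [NormedAddCommGroup E] [InnerProductSpace ℂ E]
    [NormedAddCommGroup F] [InnerProductSpace ℂ F] (A : E →ₗ[ℂ] F) (B : F →ₗ[ℂ] E) : Prop where
  aba : A ∘ₗ B ∘ₗ A = A
  bab : B ∘ₗ A ∘ₗ B = B
  symm_ab : (A ∘ₗ B).IsSymmetric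
  symm_ba : (B ∘ₗ A).IsSymmetric

end

end SphereSpline

open SphereSpline

/-!
A positive-definite operator `D` has a positive symbol, so admissibility at `t = 1` says that the
positive series `∑ N_d(n) / (a_d D̂_n)` converges. As `|P_{n,d}| ≤ 1` on `[-1, 1]`, the Green kernel
`ψ_D` is a uniformly convergent sum of continuous functions, and its traces satisfy
`∫ ψ_D(⟨r, s⟩) (D h)(s) ds = h(r)`, that is, `D ψ_n = δ_{r_n}`
(`PseudoDiffOp.ext_ofL2_greenL2`). Since `D` is injective on generalised functions
(`PseudoDiffOp.eq_zero_of_ext_eq_zero`), the span of the `ψ_n` is the space of splines. For distinct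
knots `‖∑ x_n δ_{r_n}‖_TV = ‖x‖_1` (`tvNorm_sum_dirac`, by interpolation with bump functions), and
the duality product of a spline with `D η` is `∑ x_n η(r_n)`
(`PseudoDiffOp.duality_of_ext_eq_sum_dirac`); so the objectives agree under the bijection `Ψ`, whose
inverse is its pseudo-inverse. If `D η` is a square-integrable `g`, then `η = ψ_D * g` by Fubini and
injectivity, which gives the entries of `G` as convolutions.

The harmonic analysis behind this does not use rotations. The ultraspherical differential equation
puts the zonal functions `P_{n,d}(⟨r, ·⟩)` in `Harm_n`, and the Laplace-Beltrami operator is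
symmetric (`integral_lapBel_mul`: the divergence of a compactly supported field on `ℝ^d`, in polar
coordinates). Hence convolution with `P_{j,d}` annihilates `Harm_k` for `j ≠ k`, and convolution
with any polynomial acts on `Harm_k` as a multiple of convolution with `P_{k,d}`. Applied to the
approximate identity made of the powers of `(1 + t) / 2`, this shows that a multiple of `P_{k,d}` is
a reproducing kernel of `Harm_k` (`exists_reproducing`), from which finite-dimensionality, the
addition formula and the bound `|P_{n,d}| ≤ 1` follow. The harmonic components of a smooth function
are dominated by the coefficients of the Green kernel, because powers of `Id - Δ` control the symbol
of `D`; so harmonic expansions converge in the topology of `𝒮` and `D` is injective.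
-/

namespace SphereSpline

noncomputable section

/-! ### Ultraspherical polynomials -/

section Ultraspherical

open Polynomial

/-- The ultraspherical polynomial `P_{n,d}` as an element of `ℝ[X]`. -/
def ultraPolynomial (d : ℕ) : ℕ → ℝ[X]
  | 0 => 1
  | 1 => X
  | n + 2 => C (((n : ℝ) + d - 1)⁻¹) *
      (C (2 * (n : ℝ) + d) * X * ultraPolynomial d (n + 1) - C ((n : ℝ) + 1) * ultraPolynomial d n)

theorem eval_ultraPolynomial (d : ℕ) (t : ℝ) :
    ∀ n, (ultraPolynomial d n).eval t = ultraPoly d n t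
  | 0 => by simp [ultraPolynomial, ultraPoly]
  | 1 => by simp [ultraPolynomial, ultraPoly]
  | n + 2 => by
    simp [ultraPolynomial, ultraPoly, eval_ultraPolynomial d t (n + 1),
      eval_ultraPolynomial d t n, div_eq_inv_mul]

theorem natCast_add_sub_one_pos {d : ℕ} (hd : 2 ≤ d) (n : ℕ) : (0 : ℝ) < (n : ℝ) + d - 1 := by
  have : (2 : ℝ) ≤ d := by exact_mod_cast hd
  have : (0 : ℝ) ≤ n := n.cast_nonneg
  linarith

theorem ultraPolynomial_recurrence {d : ℕ} (hd : 2 ≤ d) (n : ℕ) :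
    ((n : ℝ[X]) + (d : ℝ[X]) - 1) * ultraPolynomial d (n + 2)
      = (2 * (n : ℝ[X]) + (d : ℝ[X])) * X * ultraPolynomial d (n + 1)
        - ((n : ℝ[X]) + 1) * ultraPolynomial d n := by
  have h0 := (natCast_add_sub_one_pos hd n).ne'
  have h1 : ((n : ℝ[X]) + (d : ℝ[X]) - 1) * C (((n : ℝ) + d - 1)⁻¹) = 1 := by
    have : ((n : ℝ[X]) + (d : ℝ[X]) - 1) = C ((n : ℝ) + d - 1) := by simp
    rw [this, ← C_mul, mul_inv_cancel₀ h0, C_1]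
  rw [ultraPolynomial, ← mul_assoc, h1, one_mul]
  simp [map_ofNat (C : ℝ →+* ℝ[X]) 2]

theorem eval_one_ultraPolynomial {d : ℕ} (hd : 2 ≤ d) (n : ℕ) :
    (ultraPolynomial d n).eval 1 = 1 := by
  induction n using Nat.twoStepInduction with
  | zero => simp [ultraPolynomial]
  | one => simp [ultraPolynomial]
  | more n h1 h2 =>
    have h0 := (natCast_add_sub_one_pos hd n).ne'
    have h := congrArg (eval 1) (ultraPolynomial_recurrence hd n)
    simp [h1, h2] at h
    exact mul_left_cancel₀ h0 (by linarith)

/-- The derivative of `P_{n+1}` in terms of `P_n` and `P_{n+1}`. -/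
theorem ultraPolynomial_derivative {d : ℕ} (hd : 2 ≤ d) (n : ℕ) :
    (1 - X ^ 2) * derivative (ultraPolynomial d (n + 1))
      = ((n : ℝ[X]) + 1) * (ultraPolynomial d n - X * ultraPolynomial d (n + 1)) ∧
    (1 - X ^ 2) * derivative (ultraPolynomial d n)
      = ((n : ℝ[X]) + (d : ℝ[X]) - 2) * (X * ultraPolynomial d n - ultraPolynomial d (n + 1)) := by
  induction n with
  | zero => constructor <;> simp [ultraPolynomial]; ring
  | succ n ih =>
    obtain ⟨hA, hB⟩ := ih
    have hrec := ultraPolynomial_recurrence hd n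
    set P := ultraPolynomial d n
    set Q := ultraPolynomial d (n + 1)
    set R := ultraPolynomial d (n + 1 + 1)
    have hne : ((n : ℝ[X]) + (d : ℝ[X]) - 1) ≠ 0 := by
      have : ((n : ℝ[X]) + (d : ℝ[X]) - 1) = C ((n : ℝ) + d - 1) := by simp
      rw [this, Ne, C_eq_zero]
      exact (natCast_add_sub_one_pos hd n).ne'
    have hder := congrArg derivative hrec
    simp only [derivative_mul, derivative_add, derivative_sub, derivative_natCast, derivative_one,
      derivative_X, derivative_ofNat] at hder
    push_cast
    constructor
    · refine mul_left_cancel₀ hne ?_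
      linear_combination (1 - X ^ 2) * hder + (2 * (n : ℝ[X]) + (d : ℝ[X])) * X * hA
        - ((n : ℝ[X]) + 1) * hB + ((n : ℝ[X]) + 2) * X * hrec
    · linear_combination hA + hrec

/-- The ultraspherical differential equation. -/
theorem ultraPolynomial_ode {d : ℕ} (hd : 2 ≤ d) (n : ℕ) :
    (1 - X ^ 2) * derivative (derivative (ultraPolynomial d n))
        - ((d : ℝ[X]) - 1) * X * derivative (ultraPolynomial d n)
      = -((n : ℝ[X]) * ((n : ℝ[X]) + (d : ℝ[X]) - 2)) * ultraPolynomial d n := by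
  obtain ⟨hA, hB⟩ := ultraPolynomial_derivative hd n
  have hne : (1 - X ^ 2 : ℝ[X]) ≠ 0 := fun h => by
    have := congrArg (eval 0) h
    simp at this
  have hder := congrArg derivative hB
  simp only [derivative_mul, derivative_add, derivative_sub, derivative_natCast, derivative_one,
    derivative_X, derivative_ofNat, derivative_X_pow] at hder
  refine mul_left_cancel₀ hne ?_
  norm_num [map_ofNat (C : ℝ →+* ℝ[X]) 2] at hder
  linear_combination (1 - X ^ 2) * hder - ((n : ℝ[X]) + (d : ℝ[X]) - 2) * hA
    + (((n : ℝ[X]) + (d : ℝ[X]) - 2) * X + 2 * X - ((d : ℝ[X]) - 1) * X) * hB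

theorem span_ultraPolynomial {d : ℕ} (hd : 2 ≤ d) :
    Submodule.span ℝ (Set.range (ultraPolynomial d)) = ⊤ := by
  set S := Submodule.span ℝ (Set.range (ultraPolynomial d)) with hS
  have hmem : ∀ n, ultraPolynomial d n ∈ S := fun n => Submodule.subset_span ⟨n, rfl⟩
  have hX : ∀ q ∈ S, X * q ∈ S := by
    intro q hq
    induction hq using Submodule.span_induction with
    | mem q hq =>
      obtain ⟨n, rfl⟩ := hq
      cases n with
      | zero =>
        have := hmem 1
        simpa [ultraPolynomial] using this
      | succ n =>
        have h0 : (2 * (n : ℝ) + d) ≠ 0 := by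
          have := natCast_add_sub_one_pos hd n
          have : (0 : ℝ) ≤ n := n.cast_nonneg
          linarith
        have h : (2 * (n : ℝ) + d) • (X * ultraPolynomial d (n + 1)) ∈ S := by
          have h := ultraPolynomial_recurrence hd n
          have : (2 * (n : ℝ) + d) • (X * ultraPolynomial d (n + 1))
              = ((n : ℝ) + d - 1) • ultraPolynomial d (n + 2)
                + ((n : ℝ) + 1) • ultraPolynomial d n := by
            simp only [smul_eq_C_mul]
            simp only [map_add, map_mul, map_sub, map_natCast, map_ofNat, map_one]
            linear_combination -h
          rw [this]
          exact S.add_mem (S.smul_mem _ (hmem _)) (S.smul_mem _ (hmem _))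
        exact (S.smul_mem_iff h0).1 h
    | zero => simp
    | add p q _ _ hp hq => rw [mul_add]; exact S.add_mem hp hq
    | smul c q _ hq => rw [mul_smul_comm]; exact S.smul_mem c hq
  refine eq_top_iff.2 fun q _ => ?_
  induction q using Polynomial.induction_on with
  | C a =>
    have := S.smul_mem a (hmem 0)
    rwa [ultraPolynomial, smul_eq_C_mul, mul_one] at this
  | add p q hp hq => exact S.add_mem (hp trivial) (hq trivial)
  | monomial n a h =>
    have := hX _ (h trivial)
    rwa [show X * (C a * X ^ n) = C a * X ^ (n + 1) by ring] at this

end Ultraspherical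

/-! ### The Laplace-Beltrami operator in coordinates -/

section Laplacian

/-- The standard basis vectors of `ℝ^d`. -/
def stdVec {d : ℕ} (i : Fin d) : Amb d := EuclideanSpace.basisFun (Fin d) ℝ i

theorem norm_stdVec {d : ℕ} (i : Fin d) : ‖stdVec i‖ = 1 := by simp [stdVec]

theorem sum_inner_stdVec {d : ℕ} (x y : Amb d) :
    ∑ i, inner ℝ x (stdVec i) * inner ℝ y (stdVec i) = (inner ℝ x y : ℝ) := by
  have := (EuclideanSpace.basisFun (Fin d) ℝ).sum_inner_mul_inner x y
  rw [← this]
  refine Finset.sum_congr rfl fun i _ => ?_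
  rw [real_inner_comm y]; rfl

theorem sum_inner_smul_stdVec {d : ℕ} (x : Amb d) :
    ∑ i, (inner ℝ x (stdVec i) : ℝ) • stdVec i = x := by
  have := (EuclideanSpace.basisFun (Fin d) ℝ).sum_repr' x
  conv_rhs => rw [← this]
  refine Finset.sum_congr rfl fun i _ => ?_
  rw [real_inner_comm]; rfl

/-- The second directional derivative `∂_v ∂_v f`. -/
def dirDeriv₂ {d : ℕ} (f : Amb d → ℂ) (v x : Amb d) : ℂ :=
  fderiv ℝ (fun y => fderiv ℝ f y v) x v

theorem contDiffAt_fderiv_apply {d : ℕ} {f : Amb d → ℂ} {x : Amb d} (v : Amb d) {m n : ℕ∞ω}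
    (hf : ContDiffAt ℝ n f x) (hmn : m + 1 ≤ n) : ContDiffAt ℝ m (fun y => fderiv ℝ f y v) x :=
  (hf.fderiv_right hmn).clm_apply contDiffAt_const

theorem laplacian_eq_sum_dirDeriv₂ {d : ℕ} {f : Amb d → ℂ} {x : Amb d} (hf : ContDiffAt ℝ 2 f x) :
    Laplacian.laplacian f x = ∑ i, dirDeriv₂ f (stdVec i) x := by
  rw [InnerProductSpace.laplacian_eq_iteratedFDeriv_orthonormalBasis f
    (EuclideanSpace.basisFun (Fin d) ℝ)]
  refine Finset.sum_congr rfl fun i _ => ?_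
  have hd : DifferentiableAt ℝ (fderiv ℝ f) x :=
    (hf.fderiv_right (m := 1) (by norm_num)).differentiableAt (by norm_num)
  rw [iteratedFDeriv_two_apply, dirDeriv₂, fderiv_clm_apply hd (differentiableAt_const _)]
  simp [stdVec]

/-- The second directional derivative is the second derivative along the line. -/
theorem dirDeriv₂_eq_of_hasDerivAt {d : ℕ} {f : Amb d → ℂ} {x v : Amb d}
    (hf : ContDiffAt ℝ 2 f x) {φ : ℝ → ℂ} {c : ℂ}
    (hφ : ∀ᶠ t in 𝓝 (0 : ℝ), HasDerivAt (fun t => f (x + t • v)) (φ t) t)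
    (hc : HasDerivAt φ c 0) : dirDeriv₂ f v x = c := by
  have hline : ∀ t : ℝ, HasDerivAt (fun t : ℝ => x + t • v) v t := fun t => by
    simpa using ((hasDerivAt_id t).smul_const v).const_add x
  have hg : HasFDerivAt (fun y => fderiv ℝ f y v) (fderiv ℝ (fun y => fderiv ℝ f y v) x)
      (x + (0 : ℝ) • v) := by
    have := (contDiffAt_fderiv_apply (m := 1) v hf (by norm_num)).differentiableAt (by norm_num)
    simpa using this.hasFDerivAt
  have h1 := hg.comp_hasDerivAt (0 : ℝ) (hline 0)
  refine (h1.congr_of_eventuallyEq ?_).unique hc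
  have hcont : Tendsto (fun t : ℝ => x + t • v) (𝓝 0) (𝓝 x) := by
    have := (hline 0).continuousAt.tendsto
    simpa using this
  filter_upwards [hφ, hcont.eventually (hf.eventually (by simp))] with t ht hdt
  exact ht.unique ((hdt.differentiableAt (by norm_num)).hasFDerivAt.comp_hasDerivAt t (hline t))

variable {d : ℕ}

theorem radialExt_smul_arg (f : Sph d → ℂ) {c : ℝ} (hc : 0 < c) (x : Amb d) :
    radialExt f (c • x) = radialExt f x := by
  by_cases hx : x = 0
  · simp [hx]
  · have hcx : c • x ≠ 0 := smul_ne_zero hc.ne' hx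
    simp only [radialExt, ne_eq, hx, hcx, not_false_eq_true, dif_pos]
    congr 1
    apply Subtype.ext
    simp only [norm_smul, Real.norm_of_nonneg hc.le, smul_smul, mul_inv]
    congr 1
    field_simp

theorem radialExt_coe (f : Sph d → ℂ) (s : Sph d) : radialExt f (s : Amb d) = f s := by
  have hs : ‖(s : Amb d)‖ = 1 := norm_eq_of_mem_sphere s
  simp [radialExt, sph_coe_ne_zero s, hs]

theorem fderiv_radialExt_smul (f : Sph d → ℂ) {c : ℝ} (hc : 0 < c) (x v : Amb d) :
    fderiv ℝ (radialExt f) x v = c * fderiv ℝ (radialExt f) (c • x) v := by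
  have h := fderiv_comp_smul (𝕜 := ℝ) (f := radialExt f) (x := x) c
  rw [show (fun y => radialExt f (c • y)) = radialExt f from
    funext fun y => radialExt_smul_arg f hc y] at h
  rw [h]; simp

/-- Second derivatives of a function homogeneous of degree `0` are homogeneous of degree `-2`. -/
theorem dirDeriv₂_radialExt_smul (f : Sph d → ℂ) {c : ℝ} (hc : 0 < c) (x v : Amb d) :
    dirDeriv₂ (radialExt f) v x = c ^ 2 * dirDeriv₂ (radialExt f) v (c • x) := by
  unfold dirDeriv₂
  have h := fderiv_comp_smul (𝕜 := ℝ) (f := fun y => (c : ℂ) * fderiv ℝ (radialExt f) y v)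
    (x := x) c
  rw [show (fun y => (c : ℂ) * fderiv ℝ (radialExt f) (c • y) v)
    = fun y => fderiv ℝ (radialExt f) y v from
    funext fun y => (fderiv_radialExt_smul f hc y v).symm] at h
  rw [h]
  have h2 : (fun y => (c : ℂ) * fderiv ℝ (radialExt f) y v)
      = (c : ℝ) • fun y => fderiv ℝ (radialExt f) y v := by
    ext y; simp
  rw [h2, fderiv_const_smul_field]
  simp [pow_two, mul_assoc]

/-- Euler's identity for the radially constant extension. -/
theorem fderiv_radialExt_self {f : Sph d → ℂ} {x : Amb d}
    (hf : DifferentiableAt ℝ (radialExt f) x) : fderiv ℝ (radialExt f) x x = 0 := by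
  have hline : HasDerivAt (fun t : ℝ => x + t • x) x 0 := by
    simpa using ((hasDerivAt_id (0 : ℝ)).smul_const x).const_add x
  have hf' : HasFDerivAt (radialExt f) (fderiv ℝ (radialExt f) x) (x + (0 : ℝ) • x) := by
    simpa using hf.hasFDerivAt
  have h1 := hf'.comp_hasDerivAt (0 : ℝ) hline
  refine h1.unique ((hasDerivAt_const (0 : ℝ) (radialExt f x)).congr_of_eventuallyEq ?_)
  filter_upwards [lt_mem_nhds (show (-1 : ℝ) < 0 by norm_num)] with t ht
  have : x + t • x = (1 + t) • x := by rw [add_smul, one_smul]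
  simp only [Function.comp, this]
  exact radialExt_smul_arg f (by linarith) x

variable [Fact (2 ≤ d)]

theorem lapBel_eq_sum (h : Schw d) (s : Sph d) :
    lapBel (h : Sph d → ℂ) s
      = ∑ i, dirDeriv₂ (radialExt (h : Sph d → ℂ)) (stdVec i) (s : Amb d) :=
  laplacian_eq_sum_dirDeriv₂
    ((schw_contDiffAt_radialExt h (sph_coe_ne_zero s)).of_le two_le_infty)

/-- The restriction to the sphere of a function that is smooth near the sphere. -/
theorem contMDiff_restrict_sphere {f : Amb d → ℂ} (hf : ∀ x ≠ 0, ContDiffAt ℝ ∞ f x) :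
    ContMDiff (𝓡 (d - 1)) 𝓘(ℝ, ℂ) ∞ fun s : Sph d => f s := fun s =>
  ((hf s (sph_coe_ne_zero s)).contMDiffAt).comp s
    ((contMDiff_coe_sphere (n := d - 1) (E := Amb d) (m := ∞)) s)

theorem lapBel_contMDiff (h : Schw d) :
    ContMDiff (𝓡 (d - 1)) 𝓘(ℝ, ℂ) ∞ (lapBel (h : Sph d → ℂ)) := by
  have := contMDiff_restrict_sphere (d := d)
    (f := fun x => ∑ i, dirDeriv₂ (radialExt (h : Sph d → ℂ)) (stdVec i) x) (fun x hx => by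
      refine ContDiffAt.sum fun i _ => ?_
      exact contDiffAt_fderiv_apply _ (contDiffAt_fderiv_apply (m := ∞) _
        (schw_contDiffAt_radialExt h hx) le_rfl) le_rfl)
  refine this.congr fun s => lapBel_eq_sum h s

/-- The Laplace-Beltrami operator as a linear operator on Schwartz functions. -/
def lapSchw : Schw d →ₗ[ℂ] Schw d where
  toFun h := ⟨lapBel (h : Sph d → ℂ), lapBel_contMDiff h⟩
  map_add' f g := Subtype.ext (funext fun s => schw_lapBel_add f g s)
  map_smul' c f := Subtype.ext (funext fun s => schw_lapBel_smul c f s)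

/-- The operator `Id - Δ` on Schwartz functions. -/
def idSubLapSchw : Schw d →ₗ[ℂ] Schw d := LinearMap.id - lapSchw

theorem idSubLap_iterate_coe (n : ℕ) (h : Schw d) :
    idSubLap^[n] (h : Sph d → ℂ) = ((idSubLapSchw ^ n) h : Schw d) := by
  induction n with
  | zero => simp
  | succ n ih =>
    rw [Function.iterate_succ_apply', ih, pow_succ', Module.End.mul_apply]
    rfl

/-! ### Zonal functions -/

/-- The zonal function `s ↦ q(⟨r, s⟩)` of a real polynomial `q`. -/
def zonal (q : Polynomial ℝ) (r : Sph d) : Schw d :=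
  ⟨fun s => ((q.eval (inner ℝ (r : Amb d) (s : Amb d)) : ℝ) : ℂ),
    contMDiff_restrict_sphere (d := d)
      (f := fun x => ((q.eval (inner ℝ (r : Amb d) x) : ℝ) : ℂ)) fun x _ => by
      have h1 : ContDiffAt ℝ ∞ (fun x : Amb d => q.eval (inner ℝ (r : Amb d) x : ℝ)) x :=
        ((Polynomial.contDiff_aeval q ∞).contDiffAt :
          ContDiffAt ℝ ∞ (fun t : ℝ => q.eval t) _).comp x (contDiffAt_const.inner ℝ contDiffAt_id)
      exact (Complex.ofRealCLM.contDiff).contDiffAt.comp x h1⟩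

theorem zonal_apply (q : Polynomial ℝ) (r s : Sph d) :
    (zonal q r : Sph d → ℂ) s = ((q.eval (inner ℝ (r : Amb d) (s : Amb d)) : ℝ) : ℂ) := rfl

theorem zonal_comm (q : Polynomial ℝ) (r s : Sph d) :
    (zonal q r : Sph d → ℂ) s = (zonal q s : Sph d → ℂ) r := by
  rw [zonal_apply, zonal_apply, real_inner_comm]

theorem conj_zonal (q : Polynomial ℝ) (r s : Sph d) :
    conj ((zonal q r : Sph d → ℂ) s) = (zonal q r : Sph d → ℂ) s := by
  rw [zonal_apply, Complex.conj_ofReal]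

/-- The second derivative at `0` of `q((t + aε) / √(1 + 2bε + ε²))`. -/
theorem hasDerivAt_zonal_line (q : Polynomial ℝ) (t a b : ℝ) :
    ∃ φ : ℝ → ℝ,
      (∀ᶠ ε in 𝓝 (0 : ℝ), HasDerivAt
        (fun ε => q.eval ((t + ε * a) / √(1 + 2 * b * ε + ε ^ 2))) (φ ε) ε) ∧
      HasDerivAt φ (q.derivative.derivative.eval t * (a - t * b) ^ 2
        + q.derivative.eval t * (-2 * a * b - t + 3 * t * b ^ 2)) 0 := by
  set w : ℝ → ℝ := fun ε => (t + ε * a) / √(1 + 2 * b * ε + ε ^ 2) with hw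
  set w' : ℝ → ℝ := fun ε => (a * √(1 + 2 * b * ε + ε ^ 2)
    - (t + ε * a) * ((2 * b + 2 * ε) / (2 * √(1 + 2 * b * ε + ε ^ 2))))
      / √(1 + 2 * b * ε + ε ^ 2) ^ 2 with hw'
  have hpoly : ∀ ε : ℝ, HasDerivAt (fun ε => 1 + 2 * b * ε + ε ^ 2) (2 * b + 2 * ε) ε := fun ε => by
    have := (((hasDerivAt_id ε).const_mul (2 * b)).const_add 1).add ((hasDerivAt_id ε).pow 2)
    exact this.congr_deriv (by simp)
  have hlin : ∀ ε : ℝ, HasDerivAt (fun ε => t + ε * a) a ε := fun ε => by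
    simpa using ((hasDerivAt_id ε).mul_const a).const_add t
  have hsqrt : ∀ ε : ℝ, 0 < 1 + 2 * b * ε + ε ^ 2 →
      HasDerivAt (fun ε => √(1 + 2 * b * ε + ε ^ 2))
        ((2 * b + 2 * ε) / (2 * √(1 + 2 * b * ε + ε ^ 2))) ε := fun ε hε =>
    (hpoly ε).sqrt hε.ne'
  have hder : ∀ ε : ℝ, 0 < 1 + 2 * b * ε + ε ^ 2 → HasDerivAt w (w' ε) ε := fun ε hε =>
    (hlin ε).div (hsqrt ε hε) (Real.sqrt_pos.2 hε).ne'
  have hpos : ∀ᶠ ε in 𝓝 (0 : ℝ), 0 < 1 + 2 * b * ε + ε ^ 2 := by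
    have := (hpoly 0).continuousAt
    exact this.eventually (lt_mem_nhds (by norm_num))
  have h0 : (0 : ℝ) < 1 + 2 * b * 0 + 0 ^ 2 := by norm_num
  refine ⟨fun ε => q.derivative.eval (w ε) * w' ε, ?_, ?_⟩
  · filter_upwards [hpos] with ε hε
    exact (q.hasDerivAt (w ε)).comp ε (hder ε hε)
  · have hw0 : w 0 = t := by simp [hw]
    have hw'0 : w' 0 = a - t * b := by simp [hw']
    have hw'' : HasDerivAt w' (-2 * a * b - t + 3 * t * b ^ 2) 0 := by
      have hs := hsqrt 0 h0
      have hne : √(1 + 2 * b * 0 + 0 ^ 2) ≠ 0 := (Real.sqrt_pos.2 h0).ne'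
      have hnum : HasDerivAt (fun ε : ℝ => 2 * b + 2 * ε) 2 0 := by
        simpa using ((hasDerivAt_id (0 : ℝ)).const_mul 2).const_add (2 * b)
      have := ((hs.const_mul a).sub ((hlin 0).mul (hnum.div (hs.const_mul 2)
        (mul_ne_zero two_ne_zero hne)))).div (hs.pow 2) (pow_ne_zero 2 hne)
      refine this.congr_deriv ?_
      simp
      ring
    have h1 := ((q.derivative.hasDerivAt (w 0)).comp 0 (hder 0 h0)).mul hw''
    refine h1.congr_deriv ?_
    simp only [Function.comp, hw0, hw'0]
    ring

/-- The Laplace-Beltrami operator on zonal functions is the ultraspherical differential operator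
`(1 - t²) q'' - (d - 1) t q'`. -/
theorem lapBel_zonal (q : Polynomial ℝ) (r s : Sph d) :
    lapBel (zonal q r : Sph d → ℂ) s
      = (zonal ((1 - Polynomial.X ^ 2) * q.derivative.derivative
          - ((d : Polynomial ℝ) - 1) * Polynomial.X * q.derivative) r : Sph d → ℂ) s := by
  set t : ℝ := inner ℝ (r : Amb d) (s : Amb d) with ht
  have hr : ‖(r : Amb d)‖ = 1 := norm_eq_of_mem_sphere r
  have hs : ‖(s : Amb d)‖ = 1 := norm_eq_of_mem_sphere s
  have key : ∀ i, dirDeriv₂ (radialExt (zonal q r : Sph d → ℂ)) (stdVec i) (s : Amb d)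
      = ((q.derivative.derivative.eval t
            * (inner ℝ (r : Amb d) (stdVec i) - t * inner ℝ (s : Amb d) (stdVec i)) ^ 2
          + q.derivative.eval t
            * (-2 * inner ℝ (r : Amb d) (stdVec i) * inner ℝ (s : Amb d) (stdVec i) - t
              + 3 * t * inner ℝ (s : Amb d) (stdVec i) ^ 2) : ℝ) : ℂ) := by
    intro i
    obtain ⟨φ, hφ, hφ'⟩ := hasDerivAt_zonal_line q t (inner ℝ (r : Amb d) (stdVec i))
      (inner ℝ (s : Amb d) (stdVec i))
    refine dirDeriv₂_eq_of_hasDerivAt (φ := fun ε => (φ ε : ℂ))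
      ((schw_contDiffAt_radialExt _ (sph_coe_ne_zero s)).of_le two_le_infty) ?_ hφ'.ofReal_comp
    have hcont : ContinuousAt (fun ε : ℝ => (s : Amb d) + ε • stdVec i) 0 := by fun_prop
    have hne : ∀ᶠ ε in 𝓝 (0 : ℝ), (s : Amb d) + ε • stdVec i ≠ 0 :=
      hcont.eventually_ne (by simp [sph_coe_ne_zero s])
    filter_upwards [hφ, hne.eventually_nhds] with ε hε hne
    refine hε.ofReal_comp.congr_of_eventuallyEq ?_
    filter_upwards [hne] with ε hε
    -- along the line, the extension is `q` at `⟨r, s + ε e⟩ / ‖s + ε e‖`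
    have hnorm : ‖(s : Amb d) + ε • stdVec i‖
        = √(1 + 2 * inner ℝ (s : Amb d) (stdVec i) * ε + ε ^ 2) := by
      rw [eq_comm, Real.sqrt_eq_iff_mul_self_eq_of_pos (norm_pos_iff.2 hε), ← pow_two,
        norm_add_sq_real, hs, norm_smul, norm_stdVec, inner_smul_right]
      simp
      ring
    simp only [radialExt, hε, ne_eq, not_false_eq_true, dif_pos, zonal_apply]
    rw [inner_smul_right, inner_add_right, inner_smul_right, hnorm, ← ht, inv_mul_eq_div]
  rw [lapBel_eq_sum, Finset.sum_congr rfl fun i _ => key i, zonal_apply, ← Complex.ofReal_sum,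
    ← ht]
  congr 1
  have h1 := sum_inner_stdVec (r : Amb d) (r : Amb d)
  have h2 := sum_inner_stdVec (r : Amb d) (s : Amb d)
  have h3 := sum_inner_stdVec (s : Amb d) (s : Amb d)
  rw [real_inner_self_eq_norm_sq, hr] at h1
  rw [real_inner_self_eq_norm_sq, hs] at h3
  rw [← ht] at h2
  have hexp : ∀ a b : ℝ, q.derivative.derivative.eval t * (a - t * b) ^ 2
      + q.derivative.eval t * (-2 * a * b - t + 3 * t * b ^ 2)
      = q.derivative.derivative.eval t * (a * a)
        - (2 * t * q.derivative.derivative.eval t + 2 * q.derivative.eval t) * (a * b)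
        + (t ^ 2 * q.derivative.derivative.eval t + 3 * t * q.derivative.eval t) * (b * b)
        - t * q.derivative.eval t := fun a b => by ring
  simp only [hexp, Finset.sum_add_distrib, Finset.sum_sub_distrib, ← Finset.mul_sum, h1, h2, h3]
  simp
  ring

theorem zonal_ultraPolynomial_mem_Harm (n : ℕ) (r : Sph d) :
    zonal (ultraPolynomial d n) r ∈ Harm d n := by
  intro s
  rw [lapBel_zonal, ultraPolynomial_ode (Fact.out : 2 ≤ d), zonal_apply, zonal_apply]
  simp

end Laplacian

/-! ### Self-adjointness of the Laplace-Beltrami operator -/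

section SelfAdjoint

theorem nontrivial_amb (d : ℕ) [hd : Fact (2 ≤ d)] : Nontrivial (Amb d) := by
  refine Module.nontrivial_of_finrank_pos (R := ℝ) ?_
  have := hd.out
  simp [Amb]; omega

theorem sph_nonempty (d : ℕ) [Fact (2 ≤ d)] : Nonempty (Sph d) := by
  have := nontrivial_amb d
  exact (NormedSpace.sphere_nonempty.2 zero_le_one).to_subtype

/-- A smooth bump on the half-line, supported in `[1/2, 3/2]`. -/
def cutoffBump : ContDiffBump (1 : ℝ) := ⟨1 / 4, 1 / 2, by norm_num, by norm_num⟩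

/-- A smooth radial cut-off on `ℝ^d`, supported in an annulus around the unit sphere. -/
def cutoff {d : ℕ} (x : Amb d) : ℝ := cutoffBump (‖x‖ ^ 2)

theorem cutoff_contDiff {d : ℕ} : ContDiff ℝ ∞ (cutoff : Amb d → ℝ) :=
  cutoffBump.contDiff.comp (contDiff_norm_sq ℝ)

theorem cutoff_of_norm_eq_one {d : ℕ} {x : Amb d} (hx : ‖x‖ = 1) : cutoff x = 1 := by
  rw [cutoff, hx, one_pow]
  exact cutoffBump.one_of_mem_closedBall (by simp [cutoffBump])

theorem cutoff_eventuallyEq_zero {d : ℕ} : (cutoff : Amb d → ℝ) =ᶠ[𝓝 0] fun _ => 0 := by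
  have h : ∀ᶠ x : Amb d in 𝓝 0, ‖x‖ ^ 2 < 1 / 2 := by
    have : ContinuousAt (fun x : Amb d => ‖x‖ ^ 2) 0 := by fun_prop
    exact this.eventually (gt_mem_nhds (by norm_num))
  filter_upwards [h] with x hx
  refine cutoffBump.zero_of_le_dist ?_
  rw [Real.dist_eq, abs_sub_comm, abs_of_nonneg (by linarith)]
  change (1 / 2 : ℝ) ≤ _
  linarith

theorem cutoff_hasCompactSupport {d : ℕ} : HasCompactSupport (cutoff : Amb d → ℝ) := by
  refine HasCompactSupport.of_support_subset_isCompact (isCompact_closedBall (0 : Amb d) 2) ?_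
  intro x hx
  by_contra hxn
  rw [mem_closedBall_zero_iff, not_le] at hxn
  refine hx (cutoffBump.zero_of_le_dist ?_)
  have h4 : (4 : ℝ) ≤ ‖x‖ ^ 2 := by nlinarith
  rw [Real.dist_eq, abs_of_nonneg (by linarith)]
  change (1 / 2 : ℝ) ≤ _
  linarith

/-- The gradient of the cut-off is radial. -/
theorem hasFDerivAt_cutoff {d : ℕ} (x : Amb d) : ∃ c : ℝ, HasFDerivAt (cutoff : Amb d → ℝ)
    (c • (innerSL ℝ x : Amb d →L[ℝ] ℝ)) x := by
  have h1 : HasFDerivAt (fun x : Amb d => ‖x‖ ^ 2) (2 • (innerSL ℝ x)) x :=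
    (hasStrictFDerivAt_norm_sq x).hasFDerivAt
  have h2 : HasDerivAt cutoffBump (deriv cutoffBump (‖x‖ ^ 2)) (‖x‖ ^ 2) :=
    (cutoffBump.contDiff (n := 1)).differentiable (by norm_num) _ |>.hasDerivAt
  refine ⟨deriv cutoffBump (‖x‖ ^ 2) * 2, ?_⟩
  have h3 := h2.comp_hasFDerivAt x h1
  refine h3.congr_fderiv ?_
  ext v
  simp
  ring

/-- The integral of a directional derivative of a compactly supported function vanishes. -/
theorem integral_fderiv_eq_zero {d : ℕ} {W : Amb d → ℂ} (hW : ContDiff ℝ 1 W)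
    (hc : HasCompactSupport W) (v : Amb d) : ∫ x, fderiv ℝ W x v = 0 := by
  have hcont : Continuous fun x => fderiv ℝ W x v :=
    (hW.continuous_fderiv (by norm_num)).clm_apply continuous_const
  have hsupp : HasCompactSupport fun x => fderiv ℝ W x v :=
    hc.fderiv_apply (𝕜 := ℝ) v
  have := integral_mul_fderiv_eq_neg_fderiv_mul_of_integrable (μ := (volume : Measure (Amb d)))
    (𝕜 := ℂ) (f := fun _ => (1 : ℂ)) (g := W) (v := v) (by simp)
    (by simpa using hcont.integrable_of_hasCompactSupport hsupp)
    (by simpa using hW.continuous.integrable_of_hasCompactSupport hc)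
    (fun x _ => differentiableAt_const _) (fun x _ => hW.differentiable (by norm_num) x)
  simpa using this

/-- Integration in polar coordinates of a function that separates the variables. -/
theorem integral_polar {d : ℕ} [Fact (2 ≤ d)] {F : Amb d → ℂ} {G : Sph d → ℂ} {k : ℝ → ℂ}
    (h : ∀ (s : Sph d) (ρ : ℝ), 0 < ρ → F (ρ • (s : Amb d)) = G s * k ρ) :
    ∫ x, F x = (∫ s, G s ∂(surf d)) *
      ∫ ρ : Set.Ioi (0 : ℝ), k ρ ∂(Measure.volumeIoiPow (Module.finrank ℝ (Amb d) - 1)) := by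
  have := nontrivial_amb d
  rw [← integral_prod_mul]
  calc ∫ x, F x = ∫ x, F (Subtype.val x)
            ∂(Measure.comap (Subtype.val : ({0}ᶜ : Set (Amb d)) → Amb d) volume) := by
        rw [integral_subtype_comap (measurableSet_singleton _).compl fun x => F x,
          restrict_compl_singleton]
    _ = _ := by
      rw [← (volume : Measure (Amb d)).measurePreserving_homeomorphUnitSphereProd.integral_comp
        (Homeomorph.measurableEmbedding _)
        (fun z : Sph d × Set.Ioi (0 : ℝ) => G z.1 * k z.2)]
      refine integral_congr_ae (Eventually.of_forall fun x => ?_)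
      have hx : (x : Amb d) ≠ 0 := x.2
      simp only
      rw [← h _ _ (homeomorphUnitSphereProd (Amb d) x).2.2]
      congr 1
      simp [smul_smul, hx]

variable {d : ℕ} [Fact (2 ≤ d)]

/-- The density `χ(x) ‖x‖⁻²` has nonzero radial integral. -/
theorem integral_cutoff_radial_ne_zero :
    ∫ ρ : Set.Ioi (0 : ℝ), ((cutoffBump ((ρ : ℝ) ^ 2) * ((ρ : ℝ) ^ 2)⁻¹ : ℝ) : ℂ)
      ∂(Measure.volumeIoiPow (Module.finrank ℝ (Amb d) - 1)) ≠ 0 := by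
  intro h0
  have hcont : Continuous fun x : Amb d => cutoff x * (‖x‖ ^ 2)⁻¹ := by
    refine continuous_iff_continuousAt.2 fun x => ?_
    by_cases hx : x = 0
    · subst hx
      refine (continuousAt_const (y := (0 : ℝ))).congr ?_
      filter_upwards [cutoff_eventuallyEq_zero] with x hx
      simp [hx]
    · have : ‖x‖ ^ 2 ≠ 0 := pow_ne_zero 2 (norm_ne_zero_iff.2 hx)
      exact (cutoff_contDiff.continuous.continuousAt).mul
        (ContinuousAt.inv₀ (by fun_prop) this)
  obtain ⟨s⟩ := sph_nonempty d
  have hs : ‖(s : Amb d)‖ = 1 := norm_eq_of_mem_sphere s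
  have hpos := hcont.integral_pos_of_hasCompactSupport_nonneg_nonzero
    (μ := (volume : Measure (Amb d))) cutoff_hasCompactSupport.mul_right
    (fun x => mul_nonneg cutoffBump.nonneg (by positivity)) (x := (s : Amb d))
    (by simp [cutoff_of_norm_eq_one hs, hs])
  have hpol := integral_polar (d := d)
    (F := fun x => ((cutoff x * (‖x‖ ^ 2)⁻¹ : ℝ) : ℂ)) (G := fun _ => 1)
    (k := fun ρ => ((cutoffBump (ρ ^ 2) * (ρ ^ 2)⁻¹ : ℝ) : ℂ)) (fun s ρ hρ => by
      have hs : ‖(s : Amb d)‖ = 1 := norm_eq_of_mem_sphere s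
      simp only [cutoff, norm_smul, Real.norm_of_nonneg hρ.le, hs, mul_one, one_mul])
  rw [h0, mul_zero, integral_complex_ofReal] at hpol
  exact hpos.ne' (by exact_mod_cast hpol)

/-- The component in direction `v` of the vector field `χ (g̃ ∇f̃ - f̃ ∇g̃)`. -/
def greenField (f g : Schw d) (v x : Amb d) : ℂ :=
  (cutoff x : ℂ) * (radialExt (g : Sph d → ℂ) x * fderiv ℝ (radialExt (f : Sph d → ℂ)) x v
    - radialExt (f : Sph d → ℂ) x * fderiv ℝ (radialExt (g : Sph d → ℂ)) x v)

theorem greenField_eventuallyEq_zero (f g : Schw d) (v : Amb d) :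
    greenField f g v =ᶠ[𝓝 0] fun _ => 0 := by
  filter_upwards [cutoff_eventuallyEq_zero] with x hx
  simp [greenField, hx]

theorem greenField_contDiff (f g : Schw d) (v : Amb d) : ContDiff ℝ 1 (greenField f g v) := by
  refine contDiff_iff_contDiffAt.2 fun x => ?_
  by_cases hx : x = 0
  · subst hx
    exact contDiffAt_const.congr_of_eventuallyEq (greenField_eventuallyEq_zero f g v)
  · have hc : ContDiffAt ℝ 1 (fun x : Amb d => (cutoff x : ℂ)) x :=
      (Complex.ofRealCLM.contDiff.comp (cutoff_contDiff.of_le (by simp))).contDiffAt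
    have h1 : ∀ h : Schw d, ContDiffAt ℝ 1 (radialExt (h : Sph d → ℂ)) x := fun h =>
      (schw_contDiffAt_radialExt h hx).of_le (by simp)
    have h2 : ∀ h : Schw d, ContDiffAt ℝ 1 (fun x => fderiv ℝ (radialExt (h : Sph d → ℂ)) x v) x :=
      fun h => (contDiffAt_fderiv_apply v (m := ∞) (schw_contDiffAt_radialExt h hx)
        le_rfl).of_le (by simp)
    exact hc.mul (((h1 g).mul (h2 f)).sub ((h1 f).mul (h2 g)))

theorem greenField_hasCompactSupport (f g : Schw d) (v : Amb d) :
    HasCompactSupport (greenField f g v) := by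
  have : HasCompactSupport fun x : Amb d => (cutoff x : ℂ) :=
    cutoff_hasCompactSupport.comp_left (g := fun t : ℝ => (t : ℂ)) (by simp)
  exact this.mul_right

/-- The divergence of the field `χ (g̃ ∇f̃ - f̃ ∇g̃)`: the cut-off contributes nothing, since its
gradient is radial and those of `f̃`, `g̃` are tangential. -/
theorem sum_fderiv_greenField (f g : Schw d) (x : Amb d) :
    ∑ i, fderiv ℝ (greenField f g (stdVec i)) x (stdVec i)
      = (cutoff x : ℂ) *
        (radialExt (g : Sph d → ℂ) x * ∑ i, dirDeriv₂ (radialExt (f : Sph d → ℂ)) (stdVec i) x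
        - radialExt (f : Sph d → ℂ) x *
          ∑ i, dirDeriv₂ (radialExt (g : Sph d → ℂ)) (stdVec i) x) := by
  by_cases hx : x = 0
  · subst hx
    have : ∀ v, fderiv ℝ (greenField f g v) 0 = 0 := fun v => by
      rw [(greenField_eventuallyEq_zero f g v).fderiv_eq]; simp
    simp [this, cutoff_eventuallyEq_zero.eq_of_nhds]
  obtain ⟨c, hc⟩ := hasFDerivAt_cutoff x
  have hc' : HasFDerivAt (fun x : Amb d => (cutoff x : ℂ))
      (Complex.ofRealCLM.comp (c • (innerSL ℝ x : Amb d →L[ℝ] ℝ))) x :=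
    Complex.ofRealCLM.hasFDerivAt.comp x hc
  have h1 : ∀ h : Schw d, HasFDerivAt (radialExt (h : Sph d → ℂ))
      (fderiv ℝ (radialExt (h : Sph d → ℂ)) x) x := fun h =>
    ((schw_contDiffAt_radialExt h hx).differentiableAt (by simp)).hasFDerivAt
  have h2 : ∀ (h : Schw d) (v : Amb d),
      HasFDerivAt (fun x => fderiv ℝ (radialExt (h : Sph d → ℂ)) x v)
      (fderiv ℝ (fun x => fderiv ℝ (radialExt (h : Sph d → ℂ)) x v) x) x := fun h v =>
    ((contDiffAt_fderiv_apply v (m := ∞) (schw_contDiffAt_radialExt h hx) le_rfl).differentiableAt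
      (by simp)).hasFDerivAt
  have hterm : ∀ v, fderiv ℝ (greenField f g v) x v
      = (cutoff x : ℂ) * (radialExt (g : Sph d → ℂ) x * dirDeriv₂ (radialExt (f : Sph d → ℂ)) v x
        - radialExt (f : Sph d → ℂ) x * dirDeriv₂ (radialExt (g : Sph d → ℂ)) v x)
      + c * (radialExt (g : Sph d → ℂ) x *
          fderiv ℝ (radialExt (f : Sph d → ℂ)) x ((inner ℝ x v : ℝ) • v)
        - radialExt (f : Sph d → ℂ) x *
          fderiv ℝ (radialExt (g : Sph d → ℂ)) x ((inner ℝ x v : ℝ) • v)) := by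
    intro v
    have := hc'.mul (((h1 g).mul (h2 f v)).sub ((h1 f).mul (h2 g v)))
    rw [(show HasFDerivAt (greenField f g v) _ x from this).fderiv]
    simp [dirDeriv₂]
    ring
  have hsum : ∀ h : Schw d,
      ∑ i, fderiv ℝ (radialExt (h : Sph d → ℂ)) x ((inner ℝ x (stdVec i) : ℝ) • stdVec i) = 0 := by
    intro h
    rw [← map_sum, sum_inner_smul_stdVec]
    exact fderiv_radialExt_self ((schw_contDiffAt_radialExt h hx).differentiableAt (by simp))
  rw [Finset.sum_congr rfl fun i _ => hterm (stdVec i)]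
  rw [Finset.sum_add_distrib, ← Finset.mul_sum, ← Finset.mul_sum, Finset.sum_sub_distrib,
    Finset.sum_sub_distrib, ← Finset.mul_sum, ← Finset.mul_sum, ← Finset.mul_sum,
    ← Finset.mul_sum, hsum f, hsum g]
  ring

/-- The Laplace-Beltrami operator is symmetric. -/
theorem integral_lapBel_mul (f g : Schw d) :
    ∫ s, lapBel (f : Sph d → ℂ) s * (g : Sph d → ℂ) s ∂(surf d)
      = ∫ s, (f : Sph d → ℂ) s * lapBel (g : Sph d → ℂ) s ∂(surf d) := by
  have hint : ∀ f g : Schw d,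
      Integrable (fun s => (f : Sph d → ℂ) s * lapBel (g : Sph d → ℂ) s) (surf d) := fun f g =>
    integrable_of_continuous ((schw_continuous f).mul (lapBel_contMDiff g).continuous)
  have hint' : ∀ i, Integrable (fun x => fderiv ℝ (greenField f g (stdVec i)) x (stdVec i)) := by
    intro i
    have hW := greenField_contDiff f g (stdVec i)
    exact ((hW.continuous_fderiv (by norm_num)).clm_apply
      continuous_const).integrable_of_hasCompactSupport
      ((greenField_hasCompactSupport f g (stdVec i)).fderiv_apply (𝕜 := ℝ) _)
  have hzero : ∫ x, ∑ i, fderiv ℝ (greenField f g (stdVec i)) x (stdVec i) = 0 := by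
    rw [integral_finsetSum _ fun i _ => hint' i]
    exact Finset.sum_eq_zero fun i _ => integral_fderiv_eq_zero (greenField_contDiff f g _)
      (greenField_hasCompactSupport f g _) _
  have hscale : ∀ (h : Schw d) (s : Sph d) (ρ : ℝ), 0 < ρ →
      ∑ i, dirDeriv₂ (radialExt (h : Sph d → ℂ)) (stdVec i) (ρ • (s : Amb d))
        = ((ρ : ℂ) ^ 2)⁻¹ * lapBel (h : Sph d → ℂ) s := by
    intro h s ρ hρ
    have hne : (ρ : ℂ) ^ 2 ≠ 0 := pow_ne_zero 2 (by exact_mod_cast hρ.ne')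
    rw [lapBel_eq_sum, Finset.mul_sum]
    refine Finset.sum_congr rfl fun i _ => ?_
    rw [dirDeriv₂_radialExt_smul _ hρ (s : Amb d), ← mul_assoc, inv_mul_cancel₀ hne, one_mul]
  -- both sides of the divergence identity are of degree `-2`, up to the radial cut-off
  rw [integral_polar (G := fun s => (g : Sph d → ℂ) s * lapBel (f : Sph d → ℂ) s
      - (f : Sph d → ℂ) s * lapBel (g : Sph d → ℂ) s)
    (k := fun ρ => ((cutoffBump (ρ ^ 2) * (ρ ^ 2)⁻¹ : ℝ) : ℂ)) (fun s ρ hρ => ?_)] at hzero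
  · have := (mul_eq_zero.1 hzero).resolve_right integral_cutoff_radial_ne_zero
    rw [integral_sub (hint g f) (hint f g), sub_eq_zero] at this
    rw [← this]
    exact integral_congr_ae (Eventually.of_forall fun s => mul_comm _ _)
  · have hs : ‖(s : Amb d)‖ = 1 := norm_eq_of_mem_sphere s
    rw [sum_fderiv_greenField, hscale f s ρ hρ, hscale g s ρ hρ, radialExt_smul_arg _ hρ,
      radialExt_smul_arg _ hρ, radialExt_coe, radialExt_coe]
    simp only [cutoff, norm_smul, Real.norm_of_nonneg hρ.le, hs, mul_one]
    push_cast
    ring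

end SelfAdjoint

/-! ### Monomials and inner products on the sphere -/

section ZonalConv

/-- The monomial of degree `i` in the ambient coordinates with the given sequence of factors. -/
def sphMonomial {d : ℕ} {i : ℕ} (p : Fin i → Fin d) (s : Sph d) : ℝ := ∏ j, (s : Amb d) (p j)

theorem continuous_sphMonomial {d : ℕ} {i : ℕ} (p : Fin i → Fin d) :
    Continuous (sphMonomial p) := by
  unfold sphMonomial
  fun_prop

theorem inner_pow_eq_sum {d : ℕ} (r s : Sph d) (i : ℕ) :
    (inner ℝ (r : Amb d) (s : Amb d)) ^ i
      = ∑ p : Fin i → Fin d, sphMonomial p r * sphMonomial p s := by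
  have h : inner ℝ (r : Amb d) (s : Amb d) = ∑ a, (r : Amb d) a * (s : Amb d) a := by
    rw [PiLp.inner_apply]
    exact Finset.sum_congr rfl fun a _ => by simp [mul_comm]
  rw [h, Fintype.sum_pow]
  exact Finset.sum_congr rfl fun p _ => by simp [sphMonomial, Finset.prod_mul_distrib]

theorem sphInner_conj_symm {d : ℕ} (f g : Sph d → ℂ) : conj (sphInner f g) = sphInner g f := by
  unfold sphInner
  rw [← integral_conj]
  congr 1; ext s; simp [mul_comm]

theorem sphInner_self {d : ℕ} (f : Sph d → ℂ) :
    sphInner f f = ((∫ s, ‖f s‖ ^ 2 ∂(surf d) : ℝ) : ℂ) := by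
  unfold sphInner
  rw [← integral_complex_ofReal]
  congr 1; ext s
  rw [Complex.mul_conj, Complex.normSq_eq_norm_sq]

/-! ### Convolution with zonal polynomials -/

variable {d : ℕ} [Fact (2 ≤ d)]

/-- The convolution `r ↦ ∫ q(⟨r, s⟩) f(s) ds` of a function with a real polynomial. -/
def zonalConv (q : Polynomial ℝ) (f : Sph d → ℂ) (r : Sph d) : ℂ :=
  ∫ s, (zonal q r : Sph d → ℂ) s * f s ∂(surf d)

/-- The area `a_d` of the sphere. -/
abbrev area (d : ℕ) : ℝ := (surf d).real Set.univ

theorem area_pos : 0 < area d := by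
  have := nontrivial_amb d
  have h : surf d ≠ 0 := Measure.toSphere_ne_zero _
  exact ENNReal.toReal_pos (Measure.measure_univ_ne_zero.2 h) (measure_ne_top _ _)

theorem integrable_zonal_mul (q : Polynomial ℝ) {f : Sph d → ℂ} (hf : Continuous f) (r : Sph d) :
    Integrable (fun s => (zonal q r : Sph d → ℂ) s * f s) (surf d) :=
  integrable_of_continuous ((schw_continuous _).mul hf)

theorem zonalConv_add (p q : Polynomial ℝ) {f : Sph d → ℂ} (hf : Continuous f) (r : Sph d) :
    zonalConv (p + q) f r = zonalConv p f r + zonalConv q f r := by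
  unfold zonalConv
  rw [← integral_add (integrable_zonal_mul p hf r) (integrable_zonal_mul q hf r)]
  simp [zonal_apply, add_mul]

theorem zonalConv_smul (c : ℝ) (q : Polynomial ℝ) (f : Sph d → ℂ) (r : Sph d) :
    zonalConv (c • q) f r = c * zonalConv q f r := by
  unfold zonalConv
  rw [← integral_const_mul]
  simp [zonal_apply, mul_assoc]

theorem zonalConv_sub_right (q : Polynomial ℝ) {f g : Sph d → ℂ} (hf : Continuous f)
    (hg : Continuous g) (r : Sph d) :
    zonalConv q (fun s => f s - g s) r = zonalConv q f r - zonalConv q g r := by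
  unfold zonalConv
  rw [← integral_sub (integrable_zonal_mul q hf r) (integrable_zonal_mul q hg r)]
  simp [mul_sub]

theorem zonalConv_const_mul_right (q : Polynomial ℝ) (c : ℂ) (f : Sph d → ℂ) (r : Sph d) :
    zonalConv q (fun s => c * f s) r = c * zonalConv q f r := by
  unfold zonalConv
  rw [← integral_const_mul]
  congr 1; ext s; ring

/-- The polynomial `(1 + t) / 2`, whose powers concentrate at `t = 1`. -/
def peakPoly : Polynomial ℝ := Polynomial.C (1 / 2) * (1 + Polynomial.X)

theorem eval_peakPoly (t : ℝ) : peakPoly.eval t = (1 + t) / 2 := by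
  simp [peakPoly]; ring

/-- The normalised powers of `(1 + t) / 2` are an approximate identity. -/
theorem tendsto_zonalConv_peakPoly {f : Sph d → ℂ} (hf : Continuous f) (r : Sph d) :
    Tendsto (fun n : ℕ => (zonalConv (peakPoly ^ n) (fun _ => 1) r)⁻¹
      * zonalConv (peakPoly ^ n) f r) atTop (𝓝 (f r)) := by
  have hr : ‖(r : Amb d)‖ = 1 := norm_eq_of_mem_sphere r
  have key := tendsto_setIntegral_pow_smul_of_unique_maximum_of_isCompact_of_continuousOn
    (μ := surf d) (s := Set.univ) (x₀ := r) isCompact_univ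
    (c := fun s => peakPoly.eval (inner ℝ (r : Amb d) (s : Amb d))) (g := f)
    (by
      have : Continuous fun s : Sph d => peakPoly.eval (inner ℝ (r : Amb d) (s : Amb d)) :=
        peakPoly.continuous.comp (by fun_prop)
      exact this.continuousOn)
    (fun s _ hsr => by
      have hs : ‖(s : Amb d)‖ = 1 := norm_eq_of_mem_sphere s
      have : inner ℝ (r : Amb d) (s : Amb d) < 1 :=
        inner_lt_one_iff_real_of_norm_eq_one hr hs |>.2 fun h => hsr (Subtype.ext h.symm)
      simp only [eval_peakPoly, real_inner_self_eq_norm_sq, hr]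
      linarith)
    (fun s _ => by
      have hs : ‖(s : Amb d)‖ = 1 := norm_eq_of_mem_sphere s
      have := (abs_le.1 (abs_real_inner_le_norm (r : Amb d) (s : Amb d))).1
      rw [hr, hs] at this
      simp only [eval_peakPoly]
      linarith)
    (by simp only [eval_peakPoly, real_inner_self_eq_norm_sq, hr]; norm_num)
    (by simp) hf.continuousOn
  refine key.congr fun n => ?_
  simp only [Measure.restrict_univ, zonalConv, zonal_apply, Polynomial.eval_pow, mul_one]
  rw [integral_complex_ofReal, Complex.real_smul]
  simp

/-- A continuous function all of whose convolutions with ultraspherical polynomials vanish is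
zero. -/
theorem eq_zero_of_zonalConv_eq_zero {f : Sph d → ℂ} (hf : Continuous f)
    (h : ∀ n r, zonalConv (ultraPolynomial d n) f r = 0) (r : Sph d) : f r = 0 := by
  have hq : ∀ q : Polynomial ℝ, zonalConv q f r = 0 := by
    intro q
    have hq : q ∈ Submodule.span ℝ (Set.range (ultraPolynomial d)) := by
      rw [span_ultraPolynomial Fact.out]; trivial
    induction hq using Submodule.span_induction with
    | mem q hq => obtain ⟨n, rfl⟩ := hq; exact h n r
    | zero => simpa using zonalConv_smul 0 0 f r
    | add p q _ _ hp hq => rw [zonalConv_add _ _ hf, hp, hq, add_zero]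
    | smul c q _ hq => rw [zonalConv_smul, hq, mul_zero]
  have := tendsto_zonalConv_peakPoly hf r
  simp only [hq, mul_zero] at this
  exact (tendsto_nhds_unique this tendsto_const_nhds)

theorem zonalConv_lapBel (n : ℕ) (h : Schw d) (r : Sph d) :
    zonalConv (ultraPolynomial d n) (lapBel (h : Sph d → ℂ)) r
      = -((n : ℂ) * ((n : ℂ) + (d : ℂ) - 2))
        * zonalConv (ultraPolynomial d n) (h : Sph d → ℂ) r := by
  unfold zonalConv
  rw [← integral_lapBel_mul, ← integral_const_mul]
  refine integral_congr_ae (Eventually.of_forall fun s => ?_)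
  simp only
  rw [zonal_ultraPolynomial_mem_Harm n r s, mul_assoc]

theorem eigenvalue_injective (d : ℕ) [hd : Fact (2 ≤ d)] {j k : ℕ}
    (h : (j : ℂ) * ((j : ℂ) + (d : ℂ) - 2) = (k : ℂ) * ((k : ℂ) + (d : ℂ) - 2)) : j = k := by
  obtain ⟨e, rfl⟩ := Nat.exists_eq_add_of_le hd.out
  have h1 : (j : ℂ) * (j + e) = k * (k + e) := by
    push_cast at h
    linear_combination h
  have h2 : j * (j + e) = k * (k + e) := by exact_mod_cast h1
  rcases lt_trichotomy j k with hlt | heq | hgt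
  · nlinarith
  · exact heq
  · nlinarith

/-- Harmonics of different orders are orthogonal, having different eigenvalues. -/
theorem zonalConv_eq_zero_of_mem_Harm {j k : ℕ} (hjk : j ≠ k) {Y : Schw d} (hY : Y ∈ Harm d k)
    (r : Sph d) : zonalConv (ultraPolynomial d j) (Y : Sph d → ℂ) r = 0 := by
  have h1 := zonalConv_lapBel j Y r
  have h2 : lapBel (Y : Sph d → ℂ)
      = fun s => -((k : ℂ) * ((k : ℂ) + (d : ℂ) - 2)) * (Y : Sph d → ℂ) s := funext hY
  rw [h2, zonalConv_const_mul_right, neg_mul, neg_mul, neg_inj] at h1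
  by_contra hne
  exact hjk (eigenvalue_injective d (mul_right_cancel₀ hne h1)).symm

/-- On `Harm_k`, convolution with any zonal polynomial is a multiple of convolution with the
ultraspherical polynomial of degree `k`. -/
theorem exists_zonalConv_eq_mul (q : Polynomial ℝ) (k : ℕ) :
    ∃ b : ℂ, ∀ Y ∈ Harm d k, ∀ r, zonalConv q (Y : Sph d → ℂ) r
      = b * zonalConv (ultraPolynomial d k) (Y : Sph d → ℂ) r := by
  have hq : q ∈ Submodule.span ℝ (Set.range (ultraPolynomial d)) := by
    rw [span_ultraPolynomial Fact.out]; trivial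
  induction hq using Submodule.span_induction with
  | mem q hq =>
    obtain ⟨j, rfl⟩ := hq
    by_cases hjk : j = k
    · subst hjk
      exact ⟨1, fun Y _ r => by rw [one_mul]⟩
    · exact ⟨0, fun Y hY r => by rw [zonalConv_eq_zero_of_mem_Harm hjk hY, zero_mul]⟩
  | zero => exact ⟨0, fun Y _ r => by simpa using zonalConv_smul 0 0 (Y : Sph d → ℂ) r⟩
  | add p q _ _ hp hq =>
    obtain ⟨b, hb⟩ := hp
    obtain ⟨c, hc⟩ := hq
    exact ⟨b + c, fun Y hY r => by
      rw [zonalConv_add _ _ (schw_continuous Y), hb Y hY, hc Y hY, add_mul]⟩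
  | smul c q _ hq =>
    obtain ⟨b, hb⟩ := hq
    exact ⟨c * b, fun Y hY r => by rw [zonalConv_smul, hb Y hY, mul_assoc]⟩

theorem zonal_ultraPolynomial_self (n : ℕ) (r : Sph d) :
    (zonal (ultraPolynomial d n) r : Sph d → ℂ) r = 1 := by
  have hr : ‖(r : Amb d)‖ = 1 := norm_eq_of_mem_sphere r
  rw [zonal_apply, real_inner_self_eq_norm_sq, hr, one_pow, eval_one_ultraPolynomial Fact.out]
  simp

/-- The ultraspherical polynomial of degree `k` is, up to a scalar, a reproducing kernel of
`Harm_k`: apply the approximate identity, which acts on `Harm_k` through multiples of the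
convolution with this polynomial. -/
theorem exists_reproducing (k : ℕ) :
    ∃ β : ℝ, β ≠ 0 ∧ ∀ Y ∈ Harm d k, ∀ r, (Y : Sph d → ℂ) r
      = β * zonalConv (ultraPolynomial d k) (Y : Sph d → ℂ) r := by
  choose b hb using fun n : ℕ => exists_zonalConv_eq_mul (d := d) (peakPoly ^ n) k
  choose b₀ hb₀ using fun n : ℕ => exists_zonalConv_eq_mul (d := d) (peakPoly ^ n) 0
  -- the mass of the approximate identity does not depend on the centre, as `1 ∈ Harm_0`
  have hmass : ∀ (n : ℕ) (r : Sph d),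
      zonalConv (peakPoly ^ n) (fun _ => 1) r = b₀ n * area d := by
    intro n r
    have h1 : (zonal (ultraPolynomial d 0) r : Sph d → ℂ) = fun _ => 1 := by
      ext s; simp [zonal_apply, ultraPolynomial]
    have := hb₀ n _ (zonal_ultraPolynomial_mem_Harm 0 r) r
    rw [h1] at this
    rw [this]
    congr 1
    simp [zonalConv, h1]
  have hlim : ∀ Y ∈ Harm d k, ∀ r, Tendsto (fun n => (b₀ n * area d)⁻¹ * b n
      * zonalConv (ultraPolynomial d k) (Y : Sph d → ℂ) r) atTop (𝓝 ((Y : Sph d → ℂ) r)) := by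
    intro Y hY r
    refine (tendsto_zonalConv_peakPoly (schw_continuous Y) r).congr fun n => ?_
    rw [hmass, hb n Y hY, mul_assoc]
  obtain ⟨r₀⟩ := sph_nonempty d
  set I : ℝ := ∫ s, (ultraPolynomial d k).eval (inner ℝ (r₀ : Amb d) (s : Amb d))
    * (ultraPolynomial d k).eval (inner ℝ (r₀ : Amb d) (s : Amb d)) ∂(surf d) with hI
  have hconv : zonalConv (ultraPolynomial d k)
      (zonal (ultraPolynomial d k) r₀ : Sph d → ℂ) r₀ = I := by
    rw [hI, ← integral_complex_ofReal]
    simp [zonalConv, zonal_apply]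
  have h0 := hlim _ (zonal_ultraPolynomial_mem_Harm k r₀) r₀
  rw [hconv, zonal_ultraPolynomial_self] at h0
  have hI0 : (I : ℂ) ≠ 0 := by
    intro h
    rw [h] at h0
    simp only [mul_zero] at h0
    exact zero_ne_one (tendsto_nhds_unique tendsto_const_nhds h0)
  refine ⟨I⁻¹, inv_ne_zero (by exact_mod_cast hI0), fun Y hY r => ?_⟩
  refine tendsto_nhds_unique (hlim Y hY r) ?_
  have := (h0.div_const (I : ℂ)).mul_const
    (zonalConv (ultraPolynomial d k) (Y : Sph d → ℂ) r)
  simpa [hI0] using this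

/-! ### Harmonic bases and the addition formula -/

/-- Indices of the monomials of degree at most `N` (with repetitions). -/
abbrev MonomialIndex (d N : ℕ) : Type := (i : Fin (N + 1)) × (Fin i → Fin d)

/-- By the reproducing property, a harmonic vanishes once its moments of degree at most that of the
reproducing polynomial do. -/
instance finiteDimensional_Harm (k : ℕ) : FiniteDimensional ℂ (Harm d k) := by
  set P := ultraPolynomial d k
  have hint : ∀ (j : MonomialIndex d P.natDegree) (Y : Schw d),
      Integrable (fun s => (sphMonomial j.2 s : ℂ) * (Y : Sph d → ℂ) s) (surf d) := fun j Y =>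
    integrable_of_continuous
      ((Complex.continuous_ofReal.comp (continuous_sphMonomial j.2)).mul (schw_continuous Y))
  let M : Harm d k →ₗ[ℂ] (MonomialIndex d P.natDegree → ℂ) :=
    { toFun := fun Y j => ∫ s, (sphMonomial j.2 s : ℂ) * ((Y : Schw d) : Sph d → ℂ) s ∂(surf d)
      map_add' := fun Y Z => by
        ext j
        simp only [Pi.add_apply]
        rw [← integral_add (hint j Y) (hint j Z)]
        simp [mul_add]
      map_smul' := fun c Y => by
        ext j
        simp only [Pi.smul_apply, smul_eq_mul, RingHom.id_apply]
        rw [← integral_const_mul]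
        congr 1; ext s
        simp only [Submodule.coe_smul, Pi.smul_apply, smul_eq_mul]
        ring }
  suffices hker : ∀ Y, M Y = 0 → ∀ r, ((Y : Schw d) : Sph d → ℂ) r = 0 by
    refine Module.Finite.of_injective M fun Y Z hYZ => ?_
    have h0 : M (Y + (-1 : ℂ) • Z) = 0 := by
      rw [map_add, map_smul, hYZ]; simp
    refine Subtype.ext (Subtype.ext (funext fun r => ?_))
    have := hker _ h0 r
    simp only [Submodule.coe_add, Submodule.coe_smul, Pi.add_apply, Pi.smul_apply,
      smul_eq_mul] at this
    linear_combination this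
  intro Y hY r
  obtain ⟨β, -, hβ⟩ := exists_reproducing (d := d) k
  rw [hβ _ Y.2 r]
  have hexp : ∀ s : Sph d, (zonal P r : Sph d → ℂ) s * ((Y : Schw d) : Sph d → ℂ) s
      = ∑ i : Fin (P.natDegree + 1), ∑ p : Fin i → Fin d, ((P.coeff i * sphMonomial p r : ℝ) : ℂ)
        * ((sphMonomial p s : ℂ) * ((Y : Schw d) : Sph d → ℂ) s) := by
    intro s
    rw [zonal_apply, Polynomial.eval_eq_sum_range, Finset.sum_range]
    push_cast
    rw [Finset.sum_mul]
    refine Finset.sum_congr rfl fun i _ => ?_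
    rw [← Complex.ofReal_pow, inner_pow_eq_sum]
    push_cast
    rw [Finset.mul_sum, Finset.sum_mul]
    exact Finset.sum_congr rfl fun p _ => by ring
  have hzero : zonalConv P ((Y : Schw d) : Sph d → ℂ) r = 0 := by
    unfold zonalConv
    simp only [hexp]
    rw [integral_finsetSum _ fun i _ => integrable_finsetSum _ fun p _ =>
      (hint ⟨i, p⟩ Y).const_mul _]
    refine Finset.sum_eq_zero fun i _ => ?_
    rw [integral_finsetSum _ fun p _ => (hint ⟨i, p⟩ Y).const_mul _]
    refine Finset.sum_eq_zero fun p _ => ?_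
    rw [integral_const_mul]
    have := congrFun hY ⟨i, p⟩
    simp only [M, LinearMap.coe_mk, AddHom.coe_mk, Pi.zero_apply] at this
    rw [this, mul_zero]
  rw [hzero, mul_zero]

theorem continuous_conj_schw (f : Schw d) : Continuous fun r => conj ((f : Sph d → ℂ) r) :=
  Complex.continuous_conj.comp (schw_continuous f)

theorem integrable_mul_conj (f g : Schw d) :
    Integrable (fun s => (f : Sph d → ℂ) s * conj ((g : Sph d → ℂ) s)) (surf d) :=
  integrable_of_continuous ((schw_continuous f).mul (continuous_conj_schw g))

theorem sphInner_add_left (f g h : Schw d) :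
    sphInner ((f + g : Schw d) : Sph d → ℂ) (h : Sph d → ℂ)
      = sphInner (f : Sph d → ℂ) (h : Sph d → ℂ) + sphInner (g : Sph d → ℂ) (h : Sph d → ℂ) := by
  unfold sphInner
  rw [← integral_add (integrable_mul_conj f h) (integrable_mul_conj g h)]
  simp [add_mul]

theorem sphInner_smul_left (c : ℂ) (f h : Schw d) :
    sphInner ((c • f : Schw d) : Sph d → ℂ) (h : Sph d → ℂ)
      = c * sphInner (f : Sph d → ℂ) (h : Sph d → ℂ) := by
  unfold sphInner
  rw [← integral_const_mul]
  simp [mul_assoc]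

theorem eq_zero_of_sphInner_self {f : Schw d}
    (h : sphInner (f : Sph d → ℂ) (f : Sph d → ℂ) = 0) : f = 0 := by
  rw [sphInner_self] at h
  have hc : Continuous fun s => ‖(f : Sph d → ℂ) s‖ ^ 2 := (schw_continuous f).norm.pow 2
  have h' : ∫ s, ‖(f : Sph d → ℂ) s‖ ^ 2 ∂(surf d) = 0 := by exact_mod_cast h
  have hae := (integral_eq_zero_iff_of_nonneg (μ := surf d) (fun s => by positivity)
    (hc.integrable_of_hasCompactSupport (HasCompactSupport.of_compactSpace _))).1 h'
  have := (hc.ae_eq_iff_eq (surf d) continuous_const).1 hae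
  refine Subtype.ext (funext fun s => ?_)
  exact norm_eq_zero.1 (pow_eq_zero_iff two_ne_zero |>.1 (congrFun this s))

/-- `Harm_n` has an orthonormal basis of `N_d(n)` elements. Mathlib's inner products are
conjugate-linear in the first variable, whence the swapped arguments. -/
theorem exists_isHarmBasis (n : ℕ) : ∃ Y : Fin (mult d n) → Schw d, IsHarmBasis n Y := by
  let core : InnerProductSpace.Core ℂ (Harm d n) :=
    { inner := fun f g => sphInner ((g : Schw d) : Sph d → ℂ) ((f : Schw d) : Sph d → ℂ)
      conj_inner_symm := fun f g => sphInner_conj_symm _ _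
      re_inner_nonneg := fun f => by
        rw [sphInner_self]
        exact integral_nonneg fun s => by positivity
      add_left := fun f g h => by
        rw [← sphInner_conj_symm, Submodule.coe_add, sphInner_add_left, map_add,
          sphInner_conj_symm, sphInner_conj_symm]
      smul_left := fun f g c => by
        rw [← sphInner_conj_symm, Submodule.coe_smul, sphInner_smul_left, map_mul,
          sphInner_conj_symm]
      definite := fun f hf => Subtype.ext (eq_zero_of_sphInner_self hf) }
  let i1 : NormedAddCommGroup (Harm d n) := core.toNormedAddCommGroup
  let i2 : InnerProductSpace ℂ (Harm d n) := InnerProductSpace.ofCore core.toCore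
  let b : OrthonormalBasis (Fin (mult d n)) ℂ (Harm d n) := stdOrthonormalBasis ℂ (Harm d n)
  refine ⟨fun i => (b i : Schw d), fun i j => ?_, ?_⟩
  · have := orthonormal_iff_ite.1 b.orthonormal j i
    change sphInner _ _ = _ at this
    rw [this]
    exact if_congr eq_comm rfl rfl
  · have h1 : Submodule.span ℂ (Set.range b) = ⊤ := by
      rw [← b.coe_toBasis]; exact b.toBasis.span_eq
    have h2 : Set.range (fun i => (b i : Schw d)) = (Harm d n).subtype '' Set.range b := by
      rw [← Set.range_comp]; rfl
    rw [h2, ← Submodule.map_span, h1, Submodule.map_top, Submodule.range_subtype]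

theorem IsHarmBasis.mem {n : ℕ} {Y : Fin (mult d n) → Schw d} (hY : IsHarmBasis n Y)
    (m : Fin (mult d n)) : Y m ∈ Harm d n := by
  rw [← hY.span_eq]; exact Submodule.subset_span ⟨m, rfl⟩

theorem IsHarmBasis.sum_eq {n : ℕ} {Y : Fin (mult d n) → Schw d} (hY : IsHarmBasis n Y)
    {f : Schw d} (hf : f ∈ Harm d n) :
    f = ∑ m, sphInner (f : Sph d → ℂ) (Y m : Sph d → ℂ) • Y m := by
  rw [← hY.span_eq] at hf
  induction hf using Submodule.span_induction with
  | mem f hf =>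
    obtain ⟨i, rfl⟩ := hf
    simp [hY.orthonormal]
  | zero =>
    have : ∀ m, sphInner ((0 : Schw d) : Sph d → ℂ) (Y m : Sph d → ℂ) = 0 := fun m => by
      simpa using sphInner_smul_left 0 0 (Y m)
    exact (Finset.sum_eq_zero fun m _ => by rw [this, zero_smul]).symm
  | add f g _ _ hf hg =>
    simp only [sphInner_add_left, add_smul, Finset.sum_add_distrib]
    rw [← hf, ← hg]
  | smul c f _ hf =>
    simp only [sphInner_smul_left, mul_smul, ← Finset.smul_sum]
    rw [← hf]

theorem sphInner_zonal (q : Polynomial ℝ) (s : Sph d) (f : Sph d → ℂ) :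
    sphInner (zonal q s : Sph d → ℂ) f = conj (zonalConv q f s) := by
  unfold sphInner zonalConv
  rw [← integral_conj]
  congr 1; ext r; rw [map_mul, conj_zonal]

theorem schw_sum_apply {ι : Type*} (t : Finset ι) (f : ι → Schw d) (r : Sph d) :
    ((∑ i ∈ t, f i : Schw d) : Sph d → ℂ) r = ∑ i ∈ t, (f i : Sph d → ℂ) r := by
  rw [AddSubmonoidClass.coe_finsetSum, Finset.sum_apply]

/-- A reproducing multiple of the ultraspherical polynomial is the reproducing kernel given by an
orthonormal basis. -/
theorem IsHarmBasis.mul_zonal {n : ℕ} {Y : Fin (mult d n) → Schw d} (hY : IsHarmBasis n Y)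
    {β : ℝ} (hβ : ∀ Y ∈ Harm d n, ∀ r, (Y : Sph d → ℂ) r
      = β * zonalConv (ultraPolynomial d n) (Y : Sph d → ℂ) r) (r s : Sph d) :
    (β : ℂ) * (zonal (ultraPolynomial d n) s : Sph d → ℂ) r
      = ∑ m, (Y m : Sph d → ℂ) r * conj ((Y m : Sph d → ℂ) s) := by
  have h := congrArg (fun f : Schw d => (f : Sph d → ℂ) r)
    (hY.sum_eq (zonal_ultraPolynomial_mem_Harm n s))
  rw [h, schw_sum_apply, Finset.mul_sum]
  refine Finset.sum_congr rfl fun m _ => ?_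
  rw [hβ _ (hY.mem m) s, sphInner_zonal]
  simp only [Submodule.coe_smul, Pi.smul_apply, smul_eq_mul, map_mul, Complex.conj_ofReal]
  ring

/-- The reproducing constant is determined by the trace of the reproducing kernel. -/
theorem reproducing_const_eq {n : ℕ} {β : ℝ} (hβ : ∀ Y ∈ Harm d n, ∀ r, (Y : Sph d → ℂ) r
      = β * zonalConv (ultraPolynomial d n) (Y : Sph d → ℂ) r) : β = mult d n / area d := by
  obtain ⟨Y, hY⟩ := exists_isHarmBasis (d := d) n
  rw [eq_div_iff area_pos.ne']
  have h1 : ∀ r : Sph d, (β : ℂ) = ∑ m, (Y m : Sph d → ℂ) r * conj ((Y m : Sph d → ℂ) r) := by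
    intro r
    rw [← hY.mul_zonal hβ r r, zonal_ultraPolynomial_self, mul_one]
  have h2 : ∫ _ : Sph d, (β : ℂ) ∂(surf d) = mult d n := by
    rw [integral_congr_ae (Eventually.of_forall h1),
      integral_finsetSum _ fun m _ => integrable_mul_conj _ _]
    have : ∀ m, ∫ r, (Y m : Sph d → ℂ) r * conj ((Y m : Sph d → ℂ) r) ∂(surf d) = 1 := fun m => by
      exact (hY.orthonormal m m).trans (if_pos rfl)
    simp [this]
  rw [integral_const] at h2
  have h3 : ((area d * β : ℝ) : ℂ) = ((mult d n : ℝ) : ℂ) := by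
    push_cast
    simpa using h2
  rw [mul_comm]
  exact_mod_cast h3

/-- The reproducing property of the ultraspherical polynomials. -/
theorem reproducing {n : ℕ} {Y : Schw d} (hY : Y ∈ Harm d n) (r : Sph d) :
    (Y : Sph d → ℂ) r
      = (mult d n / area d : ℝ) * zonalConv (ultraPolynomial d n) (Y : Sph d → ℂ) r := by
  obtain ⟨β, -, hβ⟩ := exists_reproducing (d := d) n
  rw [← reproducing_const_eq hβ]
  exact hβ Y hY r

/-- The addition formula. -/
theorem addition_formula {n : ℕ} {Y : Fin (mult d n) → Schw d} (hY : IsHarmBasis n Y)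
    (r s : Sph d) : ((mult d n / area d : ℝ) : ℂ) * (zonal (ultraPolynomial d n) s : Sph d → ℂ) r
      = ∑ m, (Y m : Sph d → ℂ) r * conj ((Y m : Sph d → ℂ) s) :=
  hY.mul_zonal (fun _ hY r => reproducing hY r) r s

theorem mult_pos (n : ℕ) : 0 < mult d n := by
  obtain ⟨β, hβ0, hβ⟩ := exists_reproducing (d := d) n
  rw [reproducing_const_eq hβ] at hβ0
  exact Nat.pos_of_ne_zero fun h => hβ0 (by simp [h])

theorem mult_div_area_pos (n : ℕ) : 0 < (mult d n : ℝ) / area d :=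
  div_pos (by exact_mod_cast mult_pos n) area_pos

/-- The bound `|P_{n,d}| ≤ 1` on `[-1, 1]`, by the Cauchy-Schwarz inequality in the addition
formula. -/
theorem norm_zonal_ultraPolynomial_le_one (n : ℕ) (r s : Sph d) :
    ‖(zonal (ultraPolynomial d n) r : Sph d → ℂ) s‖ ≤ 1 := by
  obtain ⟨Y, hY⟩ := exists_isHarmBasis (d := d) n
  have hpos := mult_div_area_pos (d := d) n
  set c : ℝ := mult d n / area d
  have hdiag : ∀ r : Sph d, c = ∑ m, ‖(Y m : Sph d → ℂ) r‖ ^ 2 := by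
    intro r
    have := addition_formula hY r r
    rw [zonal_ultraPolynomial_self, mul_one] at this
    have h2 : (c : ℂ) = ((∑ m, ‖(Y m : Sph d → ℂ) r‖ ^ 2 : ℝ) : ℂ) := by
      rw [this]
      push_cast
      exact Finset.sum_congr rfl fun m _ => by
        rw [Complex.mul_conj, Complex.normSq_eq_norm_sq]; push_cast; rfl
    exact_mod_cast h2
  have h1 : c * ‖(zonal (ultraPolynomial d n) r : Sph d → ℂ) s‖ ≤ c * 1 := by
    calc c * ‖(zonal (ultraPolynomial d n) r : Sph d → ℂ) s‖
        = ‖∑ m, (Y m : Sph d → ℂ) s * conj ((Y m : Sph d → ℂ) r)‖ := by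
          rw [← addition_formula hY s r, norm_mul, Complex.norm_of_nonneg hpos.le]
      _ ≤ ∑ m, ‖(Y m : Sph d → ℂ) s‖ * ‖(Y m : Sph d → ℂ) r‖ := by
          refine (norm_sum_le _ _).trans_eq (Finset.sum_congr rfl fun m _ => ?_)
          rw [norm_mul, RCLike.norm_conj]
      _ ≤ ∑ m, (‖(Y m : Sph d → ℂ) s‖ ^ 2 + ‖(Y m : Sph d → ℂ) r‖ ^ 2) / 2 := by
          refine Finset.sum_le_sum fun m _ => ?_
          nlinarith [sq_nonneg (‖(Y m : Sph d → ℂ) s‖ - ‖(Y m : Sph d → ℂ) r‖)]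
      _ = c * 1 := by
          rw [← Finset.sum_div, Finset.sum_add_distrib, ← hdiag, ← hdiag]; ring
  exact le_of_mul_le_mul_left h1 hpos

/-- A chosen orthonormal basis of `Harm_n`. -/
def harmBasis (n : ℕ) : Fin (mult d n) → Schw d := (exists_isHarmBasis n).choose

theorem harmBasis_spec (n : ℕ) : IsHarmBasis n (harmBasis (d := d) n) :=
  (exists_isHarmBasis n).choose_spec

/-- The orthogonal projection of a Schwartz function on `Harm_n`. -/
def harmProj (n : ℕ) (h : Schw d) : Schw d :=
  ∑ m, sphInner (h : Sph d → ℂ) (harmBasis n m : Sph d → ℂ) • harmBasis n m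

theorem harmProj_mem (n : ℕ) (h : Schw d) : harmProj n h ∈ Harm d n :=
  Submodule.sum_mem _ fun m _ => Submodule.smul_mem _ _ ((harmBasis_spec n).mem m)

theorem harmProj_apply (n : ℕ) (h : Schw d) (r : Sph d) :
    (harmProj n h : Sph d → ℂ) r
      = (mult d n / area d : ℝ) * zonalConv (ultraPolynomial d n) (h : Sph d → ℂ) r := by
  unfold zonalConv
  rw [← integral_const_mul, harmProj, schw_sum_apply]
  have h1 : ∀ s, ((mult d n / area d : ℝ) : ℂ)
      * ((zonal (ultraPolynomial d n) r : Sph d → ℂ) s * (h : Sph d → ℂ) s)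
      = ∑ m, (harmBasis (d := d) n m : Sph d → ℂ) r
        * ((h : Sph d → ℂ) s * conj ((harmBasis (d := d) n m : Sph d → ℂ) s)) := by
    intro s
    rw [← mul_assoc, zonal_comm, addition_formula (harmBasis_spec n), Finset.sum_mul]
    exact Finset.sum_congr rfl fun m _ => by ring
  simp_rw [h1]
  rw [integral_finsetSum _ fun m _ => (integrable_mul_conj h _).const_mul _]
  refine Finset.sum_congr rfl fun m _ => ?_
  rw [integral_const_mul]
  simp [sphInner, mul_comm]

end ZonalConv

/-! ### Harmonic expansions and pseudo-differential operators -/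

section Expansion

variable {d : ℕ} [Fact (2 ≤ d)]

/-- Convolution with a zonal polynomial at a point, as a linear functional on Schwartz functions. -/
def zonalConvLin (q : Polynomial ℝ) (r : Sph d) : Schw d →ₗ[ℂ] ℂ where
  toFun h := zonalConv q (h : Sph d → ℂ) r
  map_add' f g := by
    unfold zonalConv
    rw [← integral_add (integrable_zonal_mul q (schw_continuous f) r)
      (integrable_zonal_mul q (schw_continuous g) r)]
    simp [mul_add]
  map_smul' c f := zonalConv_const_mul_right q c _ r

theorem zonalConvLin_apply (q : Polynomial ℝ) (r : Sph d) (h : Schw d) :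
    zonalConvLin q r h = zonalConv q (h : Sph d → ℂ) r := rfl

theorem zonalConv_harmProj_self (n : ℕ) (h : Schw d) (r : Sph d) :
    zonalConv (ultraPolynomial d n) (harmProj n h : Sph d → ℂ) r
      = zonalConv (ultraPolynomial d n) (h : Sph d → ℂ) r := by
  have h1 := reproducing (harmProj_mem n h) r
  rw [harmProj_apply] at h1
  have hne : ((mult d n / area d : ℝ) : ℂ) ≠ 0 := by
    exact_mod_cast (mult_div_area_pos n).ne'
  exact (mul_left_cancel₀ hne h1).symm

theorem zonalConv_harmProj (k n : ℕ) (h : Schw d) (r : Sph d) :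
    zonalConv (ultraPolynomial d k) (harmProj n h : Sph d → ℂ) r
      = if k = n then zonalConv (ultraPolynomial d k) (h : Sph d → ℂ) r else 0 := by
  split_ifs with hkn
  · subst hkn; exact zonalConv_harmProj_self k h r
  · exact zonalConv_eq_zero_of_mem_Harm hkn (harmProj_mem n h) r

theorem norm_zonalConv_le (n : ℕ) {f : Sph d → ℂ} (hf : Continuous f) (r : Sph d) :
    ‖zonalConv (ultraPolynomial d n) f r‖ ≤ ∫ s, ‖f s‖ ∂(surf d) := by
  refine norm_integral_le_of_norm_le (integrable_of_continuous hf).norm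
    (Eventually.of_forall fun s => ?_)
  rw [norm_mul]
  exact mul_le_of_le_one_left (norm_nonneg _) (norm_zonal_ultraPolynomial_le_one n r s)

/-- The opposite of the eigenvalue of the Laplace-Beltrami operator on `Harm_n`. -/
def harmEigenvalue (d n : ℕ) : ℝ := (n : ℝ) * ((n : ℝ) + d - 2)

theorem sq_le_harmEigenvalue (n : ℕ) : (n : ℝ) ^ 2 ≤ harmEigenvalue d n := by
  have h2 : (2 : ℝ) ≤ d := by exact_mod_cast (Fact.out : 2 ≤ d)
  have hn : (0 : ℝ) ≤ n := n.cast_nonneg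
  unfold harmEigenvalue
  nlinarith

theorem harmEigenvalue_nonneg (n : ℕ) : 0 ≤ harmEigenvalue d n :=
  (sq_nonneg _).trans (sq_le_harmEigenvalue n)

theorem harmProj_idSubLapSchw (n : ℕ) (h : Schw d) :
    harmProj n (idSubLapSchw h) = ((1 + harmEigenvalue d n : ℝ) : ℂ) • harmProj n h := by
  refine Subtype.ext (funext fun r => ?_)
  rw [Submodule.coe_smul, Pi.smul_apply, smul_eq_mul, harmProj_apply, harmProj_apply,
    ← zonalConvLin_apply, idSubLapSchw, LinearMap.sub_apply, map_sub, zonalConvLin_apply,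
    zonalConvLin_apply, LinearMap.id_apply,
    show ((lapSchw h : Schw d) : Sph d → ℂ) = lapBel (h : Sph d → ℂ) from rfl, zonalConv_lapBel,
    harmEigenvalue]
  push_cast
  ring

theorem idSubLapSchw_of_mem_Harm {n : ℕ} {Y : Schw d} (hY : Y ∈ Harm d n) :
    idSubLapSchw Y = ((1 + harmEigenvalue d n : ℝ) : ℂ) • Y := by
  refine Subtype.ext (funext fun r => ?_)
  have := hY r
  change (Y : Sph d → ℂ) r - lapBel (Y : Sph d → ℂ) r = _
  rw [this, harmEigenvalue]
  simp only [Submodule.coe_smul, Pi.smul_apply, smul_eq_mul]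
  push_cast
  ring

theorem harmProj_idSubLapSchw_pow (n j : ℕ) (h : Schw d) :
    harmProj n ((idSubLapSchw ^ j) h)
      = (((1 + harmEigenvalue d n) ^ j : ℝ) : ℂ) • harmProj n h := by
  induction j with
  | zero => simp
  | succ j ih =>
    rw [pow_succ', Module.End.mul_apply, harmProj_idSubLapSchw, ih, smul_smul]
    congr 1
    push_cast
    ring

theorem idSubLapSchw_pow_harmProj (n j : ℕ) (h : Schw d) :
    (idSubLapSchw ^ j) (harmProj n h) = harmProj n ((idSubLapSchw ^ j) h) := by
  rw [harmProj_idSubLapSchw_pow]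
  induction j with
  | zero => simp
  | succ j ih =>
    rw [pow_succ', Module.End.mul_apply, ih, map_smul, idSubLapSchw_of_mem_Harm (harmProj_mem n h),
      smul_smul]
    congr 1
    push_cast
    ring

namespace PseudoDiffOp

variable (D : PseudoDiffOp d)

/-- A pseudo-differential operator multiplies the harmonic component of order `k` by its symbol. -/
theorem zonalConv_toLin (k : ℕ) (h : Schw d) (r : Sph d) :
    zonalConv (ultraPolynomial d k) (D.toLin h : Sph d → ℂ) r
      = D.symbol k * zonalConv (ultraPolynomial d k) (h : Sph d → ℂ) r := by
  set E : ℕ → Schw d := fun K => ∑ n ∈ Finset.range K, (D.symbol n : ℂ) • harmProj n h with hE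
  have hexp := D.expansion harmBasis harmBasis_spec h
  have hE' : ∀ K r, ((D.toLin h - E K : Schw d) : Sph d → ℂ) r
      = (D.toLin h : Sph d → ℂ) r - ∑ n ∈ Finset.range K, (D.symbol n : ℂ) *
          ∑ m, sphInner (h : Sph d → ℂ) (harmBasis (d := d) n m : Sph d → ℂ)
            * (harmBasis (d := d) n m : Sph d → ℂ) r := by
    intro K r
    rw [Submodule.coe_sub, Pi.sub_apply, hE, schw_sum_apply]
    congr 1
    refine Finset.sum_congr rfl fun n _ => ?_
    rw [Submodule.coe_smul, Pi.smul_apply, harmProj, schw_sum_apply]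
    rfl
  have hL2 : Tendsto (fun K => eLpNorm ((D.toLin h - E K : Schw d) : Sph d → ℂ) 2 (surf d)) atTop
      (𝓝 0) := by
    refine hexp.congr fun K => ?_
    congr 1
    exact funext fun r => (hE' K r).symm
  have hlim : Tendsto (fun K => zonalConvLin (ultraPolynomial d k) r (D.toLin h - E K)) atTop
      (𝓝 0) := by
    rw [tendsto_zero_iff_enorm_tendsto_zero]
    have hbound := ENNReal.Tendsto.mul_const (b := surf d Set.univ ^
      (1 / (1 : ℝ≥0∞).toReal - 1 / (2 : ℝ≥0∞).toReal)) hL2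
      (Or.inr (ENNReal.rpow_ne_top_of_nonneg (by norm_num) (measure_ne_top _ _)))
    rw [zero_mul] at hbound
    refine tendsto_of_tendsto_of_tendsto_of_le_of_le tendsto_const_nhds hbound
      (fun K => zero_le) fun K => ?_
    refine le_trans ?_ (eLpNorm_le_eLpNorm_mul_rpow_measure_univ (by norm_num)
      (schw_continuous _).aestronglyMeasurable)
    rw [eLpNorm_one_eq_lintegral_enorm]
    refine (enorm_integral_le_lintegral_enorm _).trans (lintegral_mono fun s => ?_)
    rw [enorm_mul]
    refine mul_le_of_le_one_left' ?_
    rw [← ofReal_norm]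
    exact ENNReal.ofReal_le_one.2 (norm_zonal_ultraPolynomial_le_one k r s)
  have hev : ∀ᶠ K in atTop, zonalConvLin (ultraPolynomial d k) r (D.toLin h - E K)
      = zonalConv (ultraPolynomial d k) (D.toLin h : Sph d → ℂ) r
        - D.symbol k * zonalConv (ultraPolynomial d k) (h : Sph d → ℂ) r := by
    filter_upwards [eventually_gt_atTop k] with K hK
    rw [map_sub, zonalConvLin_apply, hE, map_sum]
    congr 1
    simp only [map_smul, zonalConvLin_apply, zonalConv_harmProj, smul_eq_mul]
    simp [hK]
  exact sub_eq_zero.1 (tendsto_nhds_unique (tendsto_const_nhds.congr'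
    (hev.mono fun K hK => hK.symm)) hlim)

theorem toLin_of_mem_Harm {k : ℕ} {Y : Schw d} (hY : Y ∈ Harm d k) :
    D.toLin Y = (D.symbol k : ℂ) • Y := by
  refine Subtype.ext (funext fun r => ?_)
  have h0 := eq_zero_of_zonalConv_eq_zero (schw_continuous (D.toLin Y - (D.symbol k : ℂ) • Y))
    (fun n r => by
      rw [← zonalConvLin_apply, map_sub, map_smul, zonalConvLin_apply, zonalConvLin_apply,
        D.zonalConv_toLin, smul_eq_mul]
      by_cases hnk : n = k
      · subst hnk; rw [sub_self]
      · rw [zonalConv_eq_zero_of_mem_Harm hnk hY]; ring) r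
  exact sub_eq_zero.1 h0

variable {D}

/-- Positive-definiteness, tested on a nonzero zonal harmonic, makes the symbol positive. -/
theorem symbol_pos (hpos : D.PosDef) (n : ℕ) : 0 < D.symbol n := by
  obtain ⟨r₀⟩ := sph_nonempty d
  set Y := zonal (ultraPolynomial d n) r₀
  have hY : Y ≠ 0 := fun h => by
    have h1 := zonal_ultraPolynomial_self n r₀
    change (Y : Sph d → ℂ) r₀ = 1 at h1
    rw [h] at h1
    exact zero_ne_one h1
  have h := hpos Y hY
  rw [D.toLin_of_mem_Harm (zonal_ultraPolynomial_mem_Harm n r₀), sphInner_smul_left,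
    sphInner_self, ← Complex.ofReal_mul, Complex.ofReal_re] at h
  exact pos_of_mul_pos_left h (integral_nonneg fun s => by positivity)

variable (D) in
/-- The coefficient `N_d(n) / (a_d D̂_n)` of the zonal Green kernel. -/
def greenCoeff (n : ℕ) : ℝ := (mult d n : ℝ) / (area d * D.symbol n)

theorem greenCoeff_pos (hpos : D.PosDef) (n : ℕ) : 0 < D.greenCoeff n :=
  div_pos (by exact_mod_cast mult_pos n) (mul_pos area_pos (symbol_pos hpos n))

theorem greenCoeff_mul_symbol (hpos : D.PosDef) (n : ℕ) :
    D.greenCoeff n * D.symbol n = mult d n / area d := by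
  have := (symbol_pos hpos n).ne'
  have := (area_pos (d := d)).ne'
  unfold greenCoeff
  field_simp

theorem greenPartial_eq (hpos : D.PosDef) (r s : Sph d) (K : ℕ) :
    (D.greenPartial (inner ℝ (r : Amb d) (s : Amb d)) K : ℂ)
      = ∑ n ∈ Finset.range K, (D.greenCoeff n : ℂ)
        * (zonal (ultraPolynomial d n) r : Sph d → ℂ) s := by
  rw [greenPartial, Finset.filter_true_of_mem fun n _ => (symbol_pos hpos n).ne']
  push_cast
  refine Finset.sum_congr rfl fun n _ => ?_
  rw [zonal_apply, eval_ultraPolynomial, greenCoeff]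
  push_cast
  rfl

/-- Convergence of the Green kernel on the diagonal gives summability of its coefficients. -/
theorem summable_greenCoeff (hadm : D.SplineAdmissible) (hpos : D.PosDef) :
    Summable D.greenCoeff := by
  obtain ⟨r₀⟩ := sph_nonempty d
  obtain ⟨l, hl⟩ := hadm r₀ r₀
  refine ((hasSum_iff_tendsto_nat_of_nonneg (fun n => (greenCoeff_pos hpos n).le) l).2 ?_).summable
  refine hl.congr fun K => ?_
  have h := greenPartial_eq hpos r₀ r₀ K
  simp only [zonal_ultraPolynomial_self, mul_one] at h
  exact_mod_cast h

/-- The symbol grows at most like a power of `1 - Δ`. -/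
theorem exists_symbol_le (D : PseudoDiffOp d) :
    ∃ (m : ℕ) (C : ℝ), ∀ n, |D.symbol n| ≤ C * (1 + harmEigenvalue d n) ^ m := by
  obtain ⟨p, -, hp⟩ := D.growth
  obtain ⟨m, hm⟩ := exists_nat_ge p
  have hone : ∀ n, 1 ≤ 1 + harmEigenvalue d n := fun n => by
    linarith [harmEigenvalue_nonneg (d := d) n]
  have hbig : (fun n => |D.symbol n|) =O[atTop] fun n => (1 + harmEigenvalue d n) ^ m := by
    refine hp.1.trans (Asymptotics.IsBigO.of_bound 1 ?_)
    filter_upwards [eventually_ge_atTop 1] with n hn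
    have h1 : (1 : ℝ) ≤ n := by exact_mod_cast hn
    rw [one_mul, Real.norm_of_nonneg (by positivity),
      Real.norm_of_nonneg (pow_nonneg (zero_le_one.trans (hone n)) m)]
    calc (n : ℝ) ^ p ≤ (n : ℝ) ^ (m : ℝ) := Real.rpow_le_rpow_of_exponent_le h1 hm
      _ = (n : ℝ) ^ m := Real.rpow_natCast _ _
      _ ≤ _ := by
        refine pow_le_pow_left₀ (by positivity) ?_ m
        have := sq_le_harmEigenvalue (d := d) n
        nlinarith
  obtain ⟨C, hC⟩ := (Asymptotics.isBigO_nat_atTop_iff fun n h =>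
    absurd h (pow_pos (zero_lt_one.trans_le (hone n)) m).ne').1 hbig
  refine ⟨m, C, fun n => ?_⟩
  have := hC n
  rwa [norm_abs_eq_norm, Real.norm_eq_abs,
    Real.norm_of_nonneg (pow_nonneg (zero_le_one.trans (hone n)) m)] at this

/-- The harmonic components of a Schwartz function are dominated by the coefficients of the Green
kernel. -/
theorem exists_norm_harmProj_le (hpos : D.PosDef) (h : Schw d) :
    ∃ C : ℝ, ∀ n r, ‖(harmProj n h : Sph d → ℂ) r‖ ≤ C * D.greenCoeff n := by
  -- trade `m` powers of `Id - Δ` for decay in `n`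
  obtain ⟨m, C, hC⟩ := D.exists_symbol_le
  set g := (idSubLapSchw ^ m) h
  refine ⟨C * ∫ s, ‖(g : Sph d → ℂ) s‖ ∂(surf d), fun n r => ?_⟩
  have hone : 0 < (1 + harmEigenvalue d n) ^ m :=
    pow_pos (by linarith [harmEigenvalue_nonneg (d := d) n]) m
  have h1 : (1 + harmEigenvalue d n) ^ m * ‖(harmProj n h : Sph d → ℂ) r‖
      = ‖(harmProj n g : Sph d → ℂ) r‖ := by
    rw [harmProj_idSubLapSchw_pow, Submodule.coe_smul, Pi.smul_apply, norm_smul,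
      Complex.norm_of_nonneg hone.le]
  have hsymb := hC n
  rw [abs_of_pos (symbol_pos hpos n)] at hsymb
  have hint : 0 ≤ ∫ s, ‖(g : Sph d → ℂ) s‖ ∂(surf d) := integral_nonneg fun s => norm_nonneg _
  have h2 : ‖(harmProj n g : Sph d → ℂ) r‖
      ≤ D.greenCoeff n * D.symbol n * ∫ s, ‖(g : Sph d → ℂ) s‖ ∂(surf d) := by
    rw [harmProj_apply, norm_mul, Complex.norm_of_nonneg (mult_div_area_pos n).le,
      greenCoeff_mul_symbol hpos]
    exact mul_le_mul_of_nonneg_left (norm_zonalConv_le n (schw_continuous g) r)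
      (mult_div_area_pos n).le
  refine le_of_mul_le_mul_left ?_ hone
  rw [h1]
  refine h2.trans ?_
  calc D.greenCoeff n * D.symbol n * ∫ s, ‖(g : Sph d → ℂ) s‖ ∂(surf d)
      ≤ D.greenCoeff n * (C * (1 + harmEigenvalue d n) ^ m)
        * ∫ s, ‖(g : Sph d → ℂ) s‖ ∂(surf d) := by
        have := (greenCoeff_pos hpos n).le
        gcongr
    _ = _ := by ring

/-- The harmonic expansion of a Schwartz function converges pointwise. -/
theorem hasSum_harmProj (hadm : D.SplineAdmissible) (hpos : D.PosDef) (h : Schw d) (r : Sph d) :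
    HasSum (fun n => (harmProj n h : Sph d → ℂ) r) ((h : Sph d → ℂ) r) := by
  obtain ⟨C, hC⟩ := exists_norm_harmProj_le hpos h
  have hsum : Summable fun n => C * D.greenCoeff n := (summable_greenCoeff hadm hpos).mul_left C
  have hpt : ∀ r, Summable fun n => (harmProj n h : Sph d → ℂ) r := fun r =>
    Summable.of_norm_bounded hsum fun n => hC n r
  set H : Sph d → ℂ := fun r => ∑' n, (harmProj n h : Sph d → ℂ) r with hH
  have hcont : Continuous H := continuous_tsum (fun n => schw_continuous _) hsum hC
  have hconv : ∀ k r, zonalConv (ultraPolynomial d k) H r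
      = zonalConv (ultraPolynomial d k) (h : Sph d → ℂ) r := by
    intro k r
    have h1 : HasSum (fun n => zonalConv (ultraPolynomial d k) (harmProj n h : Sph d → ℂ) r)
        (zonalConv (ultraPolynomial d k) H r) := by
      refine hasSum_integral_of_dominated_convergence (fun n _ => C * D.greenCoeff n)
        (fun n => (integrable_zonal_mul _ (schw_continuous _) r).aestronglyMeasurable)
        (fun n => Eventually.of_forall fun s => ?_) (Eventually.of_forall fun _ => hsum)
        (by simp) (Eventually.of_forall fun s => ((hpt s).hasSum).mul_left _)
      rw [norm_mul]
      exact (mul_le_of_le_one_left (norm_nonneg _)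
        (norm_zonal_ultraPolynomial_le_one k r s)).trans (hC n s)
    refine h1.unique ?_
    have h2 := hasSum_single (f := fun n =>
      zonalConv (ultraPolynomial d k) (harmProj n h : Sph d → ℂ) r) k
      fun n hn => zonalConv_eq_zero_of_mem_Harm hn.symm (harmProj_mem n h) r
    rwa [zonalConv_harmProj_self] at h2
  -- the sum of the expansion has the same harmonic components as `h`
  have h0 := eq_zero_of_zonalConv_eq_zero (hcont.sub (schw_continuous h)) (fun n r => by
    have := zonalConv_sub_right (ultraPolynomial d n) hcont (schw_continuous h) r
    rw [hconv, sub_self] at this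
    exact this) r
  have h3 : H r = (h : Sph d → ℂ) r := sub_eq_zero.1 h0
  rw [← h3]
  exact (hpt r).hasSum

/-- The harmonic expansion of a Schwartz function converges in the topology of `𝒮(𝕊^{d-1})`. -/
theorem tendsto_schwNorm_sub_sum_harmProj (hadm : D.SplineAdmissible) (hpos : D.PosDef)
    (h : Schw d) (j : ℕ) :
    Tendsto (fun K => schwNorm j (h - ∑ n ∈ Finset.range K, harmProj n h)) atTop (𝓝 0) := by
  set g := (idSubLapSchw ^ j) h
  obtain ⟨C, hC⟩ := exists_norm_harmProj_le hpos g
  have hunif := tendstoUniformly_tsum_nat ((summable_greenCoeff hadm hpos).mul_left C) hC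
  refine ENNReal.tendsto_nhds_zero.2 fun ε hε => ?_
  obtain ⟨δ, hδ0, hδ⟩ := ENNReal.lt_iff_exists_nnreal_btwn.1 hε
  filter_upwards [Metric.tendstoUniformly_iff.1 hunif δ (by exact_mod_cast hδ0)] with K hK
  refine le_trans (iSup_le fun r => ?_) hδ.le
  rw [idSubLap_iterate_coe, map_sub, map_sum, Submodule.coe_sub, Pi.sub_apply, schw_sum_apply]
  simp only [idSubLapSchw_pow_harmProj]
  have := hK r
  rw [(hasSum_harmProj hadm hpos g r).tsum_eq, dist_eq_norm] at this
  rw [← ofReal_norm]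
  exact (ENNReal.ofReal_le_ofReal this.le).trans (by simp)

/-- A pseudo-differential operator is injective on generalised functions. -/
theorem eq_zero_of_ext_eq_zero (hadm : D.SplineAdmissible) (hpos : D.PosDef)
    {u : Module.Dual ℂ (Schw d)} (hu : IsGenFun u) (h0 : D.ext u = 0) : u = 0 := by
  obtain ⟨k, C, hC⟩ := hu
  have hharm : ∀ n, ∀ Y ∈ Harm d n, u Y = 0 := by
    intro n Y hY
    have h1 : D.ext u Y = 0 := by rw [h0]; rfl
    change u (D.toLin Y) = 0 at h1
    rw [D.toLin_of_mem_Harm hY, map_smul, smul_eq_mul] at h1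
    exact (mul_eq_zero.1 h1).resolve_left (by exact_mod_cast (symbol_pos hpos n).ne')
  ext h
  have hle : ∀ K, ‖u h‖ₑ ≤ C * ∑ j ∈ Finset.range (k + 1),
      schwNorm j (h - ∑ n ∈ Finset.range K, harmProj n h) := by
    intro K
    have := hC (h - ∑ n ∈ Finset.range K, harmProj n h)
    rwa [map_sub, map_sum, Finset.sum_eq_zero fun n _ => hharm n _ (harmProj_mem n h),
      sub_zero] at this
  have hlim : Tendsto (fun K => (C : ℝ≥0∞) * ∑ j ∈ Finset.range (k + 1),
      schwNorm j (h - ∑ n ∈ Finset.range K, harmProj n h)) atTop (𝓝 0) := by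
    have h1 := tendsto_finsetSum (Finset.range (k + 1)) fun j _ =>
      tendsto_schwNorm_sub_sum_harmProj hadm hpos h j
    have := ENNReal.Tendsto.const_mul (a := (C : ℝ≥0∞)) h1 (Or.inr ENNReal.coe_ne_top)
    simpa using this
  have := ge_of_tendsto' hlim hle
  simpa using this

end PseudoDiffOp

end Expansion

/-! ### Generalised functions and measures -/

section GenFun

theorem enorm_le_supNorm {d : ℕ} (h : Sph d → ℂ) (r : Sph d) : ‖h r‖ₑ ≤ supNorm h :=
  le_iSup (fun r => ‖h r‖ₑ) r

variable {d : ℕ} [Fact (2 ≤ d)]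

/-- A functional bounded by the supremum norm is a generalised function. -/
theorem isGenFun_of_le {u : Module.Dual ℂ (Schw d)} (C : ℝ≥0)
    (h : ∀ h : Schw d, ‖u h‖ₑ ≤ C * supNorm (h : Sph d → ℂ)) : IsGenFun u :=
  ⟨0, C, fun f => by simpa [schwNorm] using h f⟩

theorem IsGenFun.sub {u v : Module.Dual ℂ (Schw d)} (hu : IsGenFun u) (hv : IsGenFun v) :
    IsGenFun (u - v) := by
  obtain ⟨k, C, hC⟩ := hu
  obtain ⟨l, B, hB⟩ := hv
  refine ⟨k + l, C + B, fun h => ?_⟩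
  have hmono : ∀ i ≤ k + l, ∑ j ∈ Finset.range (i + 1), schwNorm j h
      ≤ ∑ j ∈ Finset.range (k + l + 1), schwNorm j h := fun i hi =>
    Finset.sum_le_sum_of_subset (Finset.range_mono (by omega))
  calc ‖(u - v) h‖ₑ ≤ ‖u h‖ₑ + ‖v h‖ₑ := enorm_sub_le
    _ ≤ C * ∑ j ∈ Finset.range (k + l + 1), schwNorm j h
        + B * ∑ j ∈ Finset.range (k + l + 1), schwNorm j h := by
      gcongr
      · exact (hC h).trans (mul_le_mul_right (hmono k (by omega)) _)
      · exact (hB h).trans (mul_le_mul_right (hmono l (by omega)) _)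
    _ = _ := by rw [← add_mul]; push_cast; rfl

theorem enorm_integral_mul_le {g : Sph d → ℂ} (hg : Integrable g (surf d)) (h : Schw d) :
    ‖∫ s, g s * (h : Sph d → ℂ) s ∂(surf d)‖ₑ
      ≤ ((∫⁻ s, ‖g s‖ₑ ∂(surf d)).toNNReal : ℝ≥0) * supNorm (h : Sph d → ℂ) := by
  rw [ENNReal.coe_toNNReal hg.2.ne, ← lintegral_mul_const'' _ hg.1.enorm]
  refine (enorm_integral_le_lintegral_enorm _).trans (lintegral_mono fun s => ?_)
  rw [enorm_mul]
  exact mul_le_mul_right (enorm_le_supNorm _ s) _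

theorem isGenFun_ofL2 (g : Lp ℂ 2 (surf d)) : IsGenFun (ofL2 g) :=
  isGenFun_of_le _ fun h => enorm_integral_mul_le ((Lp.memLp g).integrable (by norm_num)) h

theorem isGenFun_ofCont (η : C(Sph d, ℂ)) : IsGenFun (ofCont η) :=
  isGenFun_of_le _ fun h => enorm_integral_mul_le (integrable_of_continuous η.continuous) h

theorem ofCont_injective : Function.Injective (ofCont (d := d)) := by
  intro η θ h
  refine ContinuousMap.ext fun r => sub_eq_zero.1 ?_
  refine eq_zero_of_zonalConv_eq_zero (η.continuous.sub θ.continuous) (fun n r => ?_) r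
  refine (zonalConv_sub_right _ η.continuous θ.continuous r).trans (sub_eq_zero.2 ?_)
  have : ∫ s, η s * (zonal (ultraPolynomial d n) r : Sph d → ℂ) s ∂(surf d)
      = ∫ s, θ s * (zonal (ultraPolynomial d n) r : Sph d → ℂ) s ∂(surf d) :=
    congrArg (fun u : Module.Dual ℂ (Schw d) => u (zonal (ultraPolynomial d n) r)) h
  simpa only [zonalConv, mul_comm] using this

/-- Schwartz functions are dense in the continuous functions. -/
theorem denseRange_toCont : DenseRange (toCont (d := d)) := by
  let A : StarSubalgebra ℂ C(Sph d, ℂ) :=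
    { carrier := {f | ContMDiff (𝓡 (d - 1)) 𝓘(ℝ, ℂ) ∞ f}
      mul_mem' := fun {f g} hf hg => by
        have hm : ContDiff ℝ ∞ fun z : ℂ × ℂ => z.1 * z.2 := contDiff_mul
        exact hm.contMDiff.comp (hf.prodMk_space hg)
      add_mem' := fun hf hg => ContMDiff.add hf hg
      algebraMap_mem' := fun c => contMDiff_const
      star_mem' := fun {f} hf =>
        (Complex.conjCLE.toContinuousLinearMap.contDiff).contMDiff.comp hf }
  have hsep : A.toSubalgebra.SeparatesPoints := by
    intro r s hrs
    refine ⟨zonal Polynomial.X r, ⟨toCont (zonal Polynomial.X r), (zonal Polynomial.X r).2, rfl⟩,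
      fun h => hrs ?_⟩
    have hr : ‖(r : Amb d)‖ = 1 := norm_eq_of_mem_sphere r
    have hs : ‖(s : Amb d)‖ = 1 := norm_eq_of_mem_sphere s
    simp only [zonal_apply, Polynomial.eval_X, Complex.ofReal_inj] at h
    rw [real_inner_self_eq_norm_sq, hr, one_pow, eq_comm, inner_eq_one_iff_of_norm_eq_one hr hs]
      at h
    exact Subtype.ext h
  have htop := ContinuousMap.starSubalgebra_topologicalClosure_eq_top_of_separatesPoints A hsep
  have hset : (A : Set C(Sph d, ℂ)) = Set.range toCont := by
    ext f
    exact ⟨fun hf => ⟨⟨f, hf⟩, rfl⟩, by rintro ⟨h, rfl⟩; exact h.2⟩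
  rw [DenseRange, ← hset, dense_iff_closure_eq, ← StarSubalgebra.topologicalClosure_coe, htop]
  rfl

theorem sum_dirac_apply {ι : Type*} [Fintype ι] (α : ι → ℂ) (r : ι → Sph d) (h : Schw d) :
    (∑ n, α n • dirac (r n)) h = ∑ n, α n * (h : Sph d → ℂ) (r n) := by
  rw [LinearMap.sum_apply]
  rfl

theorem enorm_sum_dirac_le {ι : Type*} [Fintype ι] (α : ι → ℂ) (r : ι → Sph d) (h : Schw d) :
    ‖(∑ n, α n • dirac (r n)) h‖ₑ ≤ (∑ n, ‖α n‖ₑ) * supNorm (h : Sph d → ℂ) := by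
  rw [sum_dirac_apply, Finset.sum_mul]
  refine (enorm_sum_le _ _).trans (Finset.sum_le_sum fun n _ => ?_)
  rw [enorm_mul]
  exact mul_le_mul_right (enorm_le_supNorm _ _) _

theorem isGenFun_sum_dirac {ι : Type*} [Fintype ι] (α : ι → ℂ) (r : ι → Sph d) :
    IsGenFun (∑ n, α n • dirac (r n)) :=
  isGenFun_of_le (∑ n, ‖α n‖₊) fun h => by
    simpa [enorm_eq_nnnorm] using enorm_sum_dirac_le α r h

/-- Interpolation of unimodular values at distinct points by a Schwartz function of norm `1`. -/
theorem exists_schw_interpolating {N : ℕ} [NeZero N] {r : Fin N → Sph d}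
    (hr : Function.Injective r) (θ : Fin N → ℂ) (hθ : ∀ n, ‖θ n‖ = 1) :
    ∃ h : Schw d, supNorm (h : Sph d → ℂ) = 1 ∧ ∀ n, (h : Sph d → ℂ) (r n) = θ n := by
  -- bumps at the points, with disjoint supports
  obtain ⟨δ, hδ, hδ0⟩ : ∃ δ : ℝ, (∀ m n, m ≠ n → δ < dist (r m : Amb d) (r n : Amb d)) ∧ 0 < δ := by
    have h1 : ∀ᶠ δ : ℝ in 𝓝[>] 0, ∀ m n, m ≠ n → δ < dist (r m : Amb d) (r n : Amb d) := by
      refine eventually_all.2 fun m => eventually_all.2 fun n => ?_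
      by_cases hmn : m = n
      · simp [hmn]
      · have : (0 : ℝ) < dist (r m : Amb d) (r n : Amb d) :=
          dist_pos.2 fun h => hmn (hr (Subtype.ext h))
        filter_upwards [nhdsWithin_le_nhds (gt_mem_nhds this)] with δ hδ _ using hδ
    exact (h1.and self_mem_nhdsWithin).exists
  let b : (n : Fin N) → ContDiffBump (r n : Amb d) := fun n =>
    ⟨δ / 4, δ / 2, by linarith, by linarith⟩
  have happly : ∀ s : Sph d, ∀ m : Fin N, δ / 2 ≤ dist (s : Amb d) (r m) →
      θ m * (b m (s : Amb d) : ℂ) = 0 := fun s m hm => by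
    rw [(b m).zero_of_le_dist hm, Complex.ofReal_zero, mul_zero]
  let h : Schw d := ⟨fun s => ∑ n, θ n * (b n (s : Amb d) : ℂ),
    contMDiff_restrict_sphere (d := d) (f := fun x => ∑ n, θ n * (b n x : ℂ)) fun x _ =>
      ContDiffAt.sum fun n _ => contDiffAt_const.mul
        ((Complex.ofRealCLM.contDiff.comp (b n).contDiff).contDiffAt)⟩
  have hsingle : ∀ (s : Sph d) (m : Fin N), dist (s : Amb d) (r m) < δ / 2 →
      (h : Sph d → ℂ) s = θ m * (b m (s : Amb d) : ℂ) := by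
    intro s m hm
    refine Finset.sum_eq_single m (fun n _ hnm => happly s n ?_)
      fun hm => absurd (Finset.mem_univ m) hm
    have h2 := hδ n m hnm
    have h3 := dist_triangle_left (r n : Amb d) (r m : Amb d) (s : Amb d)
    linarith
  have hval : ∀ n, (h : Sph d → ℂ) (r n) = θ n := by
    intro n
    rw [hsingle (r n) n (by simpa using hδ0), (b n).one_of_mem_closedBall
      (mem_closedBall_self (b n).rIn_pos.le), Complex.ofReal_one, mul_one]
  have hle : ∀ s, ‖(h : Sph d → ℂ) s‖ ≤ 1 := by
    intro s
    by_cases hs : ∃ m, dist (s : Amb d) (r m) < δ / 2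
    · obtain ⟨m, hm⟩ := hs
      rw [hsingle s m hm, norm_mul, hθ, one_mul, Complex.norm_of_nonneg (b m).nonneg]
      exact (b m).le_one
    · push Not at hs
      have h0 : (h : Sph d → ℂ) s = 0 := 
        Finset.sum_eq_zero (s := Finset.univ) fun n _ => happly s n (hs n)
      simp [h0]
  refine ⟨h, le_antisymm (iSup_le fun s => ?_) ?_, hval⟩
  · rw [← ofReal_norm]
    exact ENNReal.ofReal_le_one.2 (hle s)
  · have h1 := enorm_le_supNorm (h : Sph d → ℂ) (r 0)
    rwa [hval, ← ofReal_norm, hθ, ENNReal.ofReal_one] at h1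

/-- The total variation of a discrete measure with distinct knots. -/
theorem tvNorm_sum_dirac {N : ℕ} {r : Fin N → Sph d} (hr : Function.Injective r)
    (α : Fin N → ℂ) : tvNorm (∑ n, α n • dirac (r n)) = ∑ n, ‖α n‖ₑ := by
  refine le_antisymm (iSup₂_le fun h hh => ?_) ?_
  · simpa [hh] using enorm_sum_dirac_le α r h
  · rcases Nat.eq_zero_or_pos N with rfl | hN
    · simp
    have : NeZero N := ⟨hN.ne'⟩
    -- test against a function taking the conjugate phases of the amplitudes at the knots
    have hphase : ∀ z : ℂ, ∃ θ : ℂ, ‖θ‖ = 1 ∧ z * θ = ‖z‖ := by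
      intro z
      by_cases hz : z = 0
      · exact ⟨1, by simp, by simp [hz]⟩
      · have hn : (‖z‖ : ℂ) ≠ 0 := by exact_mod_cast norm_ne_zero_iff.2 hz
        refine ⟨conj z / ‖z‖, by simp [hz], ?_⟩
        rw [← mul_div_assoc, Complex.mul_conj, Complex.normSq_eq_norm_sq]
        push_cast
        rw [pow_two, mul_div_cancel_left₀ _ hn]
    choose θ hθ1 hθ2 using fun n => hphase (α n)
    obtain ⟨h, hsup, hval⟩ := exists_schw_interpolating hr θ hθ1
    refine le_trans (le_of_eq ?_) (le_iSup₂ (f := fun (h : Schw d)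
      (_ : supNorm (h : Sph d → ℂ) = 1) => ‖(∑ n, α n • dirac (r n)) h‖ₑ) h hsup)
    simp only [sum_dirac_apply, hval, hθ2]
    rw [← Complex.ofReal_sum, ← ofReal_norm,
      Complex.norm_of_nonneg (Finset.sum_nonneg fun n _ => norm_nonneg _),
      ENNReal.ofReal_sum_of_nonneg fun n _ => norm_nonneg _]
    simp only [ofReal_norm]

end GenFun

/-! ### The zonal Green kernel -/

namespace PseudoDiffOp

variable {d : ℕ} [Fact (2 ≤ d)] {D : PseudoDiffOp d}

theorem norm_greenCoeff_mul_zonal_le (hpos : D.PosDef) (n : ℕ) (r s : Sph d) :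
    ‖(D.greenCoeff n : ℂ) * (zonal (ultraPolynomial d n) r : Sph d → ℂ) s‖ ≤ D.greenCoeff n := by
  rw [norm_mul, Complex.norm_of_nonneg (greenCoeff_pos hpos n).le]
  exact mul_le_of_le_one_right (greenCoeff_pos hpos n).le
    (norm_zonal_ultraPolynomial_le_one n r s)

theorem hasSum_trace (hadm : D.SplineAdmissible) (hpos : D.PosDef) (r s : Sph d) :
    HasSum (fun n => (D.greenCoeff n : ℂ) * (zonal (ultraPolynomial d n) r : Sph d → ℂ) s)
      (D.trace s r) := by
  obtain ⟨l, hl⟩ := hadm r s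
  have hsum : Summable fun n =>
      (D.greenCoeff n : ℂ) * (zonal (ultraPolynomial d n) r : Sph d → ℂ) s :=
    Summable.of_norm_bounded (summable_greenCoeff hadm hpos)
      fun n => norm_greenCoeff_mul_zonal_le hpos n r s
  have htr : D.trace s r = l := by rw [trace, green, hl.limUnder_eq]
  have hl' : Tendsto (fun K => (D.greenPartial (inner ℝ (r : Amb d) (s : Amb d)) K : ℂ)) atTop
      (𝓝 (l : ℂ)) := (Complex.continuous_ofReal.tendsto l).comp hl
  simp only [greenPartial_eq hpos] at hl'
  rw [htr, ← tendsto_nhds_unique hsum.hasSum.tendsto_sum_nat hl']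
  exact hsum.hasSum

theorem trace_comm (D : PseudoDiffOp d) (r s : Sph d) : D.trace r s = D.trace s r := by
  rw [trace, trace, real_inner_comm]

theorem continuous_zonal_uncurry (q : Polynomial ℝ) :
    Continuous fun p : Sph d × Sph d => (zonal q p.1 : Sph d → ℂ) p.2 := by
  simp only [zonal_apply]
  exact Complex.continuous_ofReal.comp (q.continuous.comp (by fun_prop))

theorem continuous_trace_uncurry (hadm : D.SplineAdmissible) (hpos : D.PosDef) :
    Continuous (Function.uncurry D.trace) := by
  have h := continuous_tsum (f := fun n (p : Sph d × Sph d) => (D.greenCoeff n : ℂ)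
    * (zonal (ultraPolynomial d n) p.1 : Sph d → ℂ) p.2)
    (fun n => continuous_const.mul (continuous_zonal_uncurry _)) (summable_greenCoeff hadm hpos)
    (fun n p => norm_greenCoeff_mul_zonal_le hpos n p.1 p.2)
  refine h.congr fun p => ?_
  rw [(hasSum_trace hadm hpos p.1 p.2).tsum_eq, trace_comm, Function.uncurry_def]

theorem continuous_trace (hadm : D.SplineAdmissible) (hpos : D.PosDef) (r : Sph d) :
    Continuous (D.trace r) :=
  (continuous_trace_uncurry hadm hpos).uncurry_left r

theorem exists_norm_trace_le (hadm : D.SplineAdmissible) (hpos : D.PosDef) :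
    ∃ C : ℝ, ∀ r s : Sph d, ‖D.trace r s‖ ≤ C :=
  ⟨∑' n, D.greenCoeff n, fun r s => (hasSum_trace hadm hpos s r).norm_le_of_bounded
    (summable_greenCoeff hadm hpos).hasSum fun n => norm_greenCoeff_mul_zonal_le hpos n s r⟩

theorem memLp_trace (hadm : D.SplineAdmissible) (hpos : D.PosDef) (r : Sph d) :
    MemLp (D.trace r) 2 (surf d) := by
  obtain ⟨C, hC⟩ := exists_norm_trace_le hadm hpos
  exact MemLp.of_bound (continuous_trace hadm hpos r).aestronglyMeasurable C
    (Eventually.of_forall fun s => hC r s)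

/-- The traces of the zonal Green kernel are fundamental solutions: `⟨ψ_r, D h⟩ = h(r)`. -/
theorem integral_trace_mul_toLin (hadm : D.SplineAdmissible) (hpos : D.PosDef) (h : Schw d)
    (r : Sph d) :
    ∫ s, D.trace r s * (D.toLin h : Sph d → ℂ) s ∂(surf d) = (h : Sph d → ℂ) r := by
  have hsumm := summable_greenCoeff hadm hpos
  have h1 : HasSum (fun n => ∫ s, (D.greenCoeff n : ℂ)
      * (zonal (ultraPolynomial d n) r : Sph d → ℂ) s * (D.toLin h : Sph d → ℂ) s ∂(surf d))
      (∫ s, D.trace r s * (D.toLin h : Sph d → ℂ) s ∂(surf d)) := by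
    refine hasSum_integral_of_dominated_convergence
      (fun n s => D.greenCoeff n * ‖(D.toLin h : Sph d → ℂ) s‖)
      (fun n => ((continuous_const.mul (schw_continuous _)).mul
        (schw_continuous _)).aestronglyMeasurable)
      (fun n => Eventually.of_forall fun s => ?_)
      (Eventually.of_forall fun s => hsumm.mul_right _) ?_ (Eventually.of_forall fun s => ?_)
    · rw [norm_mul]
      exact mul_le_mul_of_nonneg_right (norm_greenCoeff_mul_zonal_le hpos n r s) (norm_nonneg _)
    · simp only [tsum_mul_right]
      exact (integrable_of_continuous (schw_continuous _)).norm.const_mul _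
    · rw [trace_comm]
      exact (hasSum_trace hadm hpos r s).mul_right _
  refine h1.unique ?_
  convert hasSum_harmProj hadm hpos h r using 2 with n
  rw [harmProj_apply]
  simp only [mul_assoc]
  rw [integral_const_mul]
  change (D.greenCoeff n : ℂ)
    * zonalConv (ultraPolynomial d n) (D.toLin h : Sph d → ℂ) r = _
  rw [D.zonalConv_toLin, ← mul_assoc, ← Complex.ofReal_mul, greenCoeff_mul_symbol hpos]

theorem greenL2_coeFn (hadm : D.SplineAdmissible) (hpos : D.PosDef) (r : Sph d) :
    D.greenL2 r =ᵐ[surf d] D.trace r := by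
  rw [greenL2, dif_pos (memLp_trace hadm hpos r)]
  exact MemLp.coeFn_toLp _

theorem ext_ofL2_greenL2 (hadm : D.SplineAdmissible) (hpos : D.PosDef) (r : Sph d) :
    D.ext (ofL2 (D.greenL2 r)) = dirac r := by
  ext h
  change ∫ s, D.greenL2 r s * (D.toLin h : Sph d → ℂ) s ∂(surf d) = (h : Sph d → ℂ) r
  rw [← integral_trace_mul_toLin hadm hpos h r]
  refine integral_congr_ae ?_
  filter_upwards [greenL2_coeFn hadm hpos r] with s hs
  rw [hs]

variable {N : ℕ} {r : Fin N → Sph d}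

theorem synthesis_coe (D : PseudoDiffOp d) (r : Fin N → Sph d) (x : EuclideanSpace ℂ (Fin N)) :
    (D.synthesis r x : Lp ℂ 2 (surf d)) = ∑ n, x n • D.greenL2 (r n) := rfl

theorem ext_ofL2_synthesis (hadm : D.SplineAdmissible) (hpos : D.PosDef)
    (x : EuclideanSpace ℂ (Fin N)) :
    D.ext (ofL2 (D.synthesis r x : Lp ℂ 2 (surf d))) = ∑ n, x n • dirac (r n) := by
  simp only [synthesis_coe, map_sum, map_smul, ext_ofL2_greenL2 hadm hpos]

theorem synthesis_bijective (hadm : D.SplineAdmissible) (hpos : D.PosDef)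
    (hr : Function.Injective r) : Function.Bijective (D.synthesis r) := by
  constructor
  · refine (injective_iff_map_eq_zero _).2 fun x hx => ?_
    have h := ext_ofL2_synthesis (r := r) hadm hpos x
    have h2 := tvNorm_sum_dirac hr fun n => x n
    rw [← h, hx] at h2
    have h3 : tvNorm (D.ext (ofL2 ((0 : D.splineSpan r) : Lp ℂ 2 (surf d)))) = 0 := by
      simp [tvNorm]
    rw [h3, eq_comm, Finset.sum_eq_zero_iff] at h2
    ext n
    simpa using h2 n (Finset.mem_univ n)
  · rintro ⟨f, hf⟩
    obtain ⟨c, hc⟩ := (Submodule.mem_span_range_iff_exists_fun ℂ).1 hf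
    exact ⟨WithLp.toLp 2 c, Subtype.ext hc⟩

theorem image_ofL2_splineSpan (hadm : D.SplineAdmissible) (hpos : D.PosDef)
    (hr : Function.Injective r) :
    ofL2 '' (D.splineSpan r : Set (Lp ℂ 2 (surf d))) = D.splines r := by
  ext s
  constructor
  · rintro ⟨f, hf, rfl⟩
    obtain ⟨x, hx⟩ := (synthesis_bijective hadm hpos hr).2 ⟨f, hf⟩
    have h := ext_ofL2_synthesis (r := r) hadm hpos x
    rw [hx] at h
    exact ⟨isGenFun_ofL2 f, fun n => x n, h⟩
  · rintro ⟨hs, α, hα⟩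
    have h := ext_ofL2_synthesis (r := r) hadm hpos (WithLp.toLp 2 α)
    have h0 := eq_zero_of_ext_eq_zero hadm hpos (hs.sub (isGenFun_ofL2 (D.synthesis r
      (WithLp.toLp 2 α) : Lp ℂ 2 (surf d)))) (by rw [map_sub, h, hα]; exact sub_self _)
    exact ⟨_, (D.synthesis r (WithLp.toLp 2 α)).2, (sub_eq_zero.1 h0).symm⟩

theorem splines_subset_searchSpace (hr : Function.Injective r) :
    D.splines r ⊆ D.searchSpace := by
  rintro s ⟨hs, α, hα⟩
  refine ⟨hs, ?_⟩
  rw [hα]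
  refine ⟨isGenFun_sum_dirac α r, ?_⟩
  rw [tvNorm_sum_dirac hr]
  exact ENNReal.sum_lt_top.2 fun n _ => enorm_lt_top

/-! ### The duality product -/

/-- The duality product does not depend on the choice of the extension of `D f` to continuous
functions, by density of `𝒮`, nor on that of `η`, by injectivity of `D`. -/
theorem duality_eq (hadm : D.SplineAdmissible) (hpos : D.PosDef)
    {f φ : Module.Dual ℂ (Schw d)} {T : C(Sph d, ℂ) →L[ℂ] ℂ}
    (hT : ∀ h : Schw d, T (toCont h) = D.ext f h) {η : C(Sph d, ℂ)}
    (hη : φ = D.ext (ofCont η)) : D.duality f φ = T η := by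
  have H : ∃ z, D.IsDualityValue f φ z := ⟨T η, T, hT, η, hη, rfl⟩
  rw [duality, dif_pos H]
  obtain ⟨T', hT', η', hη', hz⟩ := H.choose_spec
  rw [← hz]
  have hTT : (T' : C(Sph d, ℂ) → ℂ) = T :=
    denseRange_toCont.equalizer T'.continuous T.continuous (funext fun h => by
      simp only [Function.comp, hT, hT'])
  have hηη : η' = η := by
    have h0 := eq_zero_of_ext_eq_zero hadm hpos ((isGenFun_ofCont η').sub (isGenFun_ofCont η))
      (by rw [map_sub, ← hη, ← hη', sub_self])
    exact ofCont_injective (sub_eq_zero.1 h0)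
  rw [hTT, hηη]

/-- Against a spline, the duality product is a weighted sum of point evaluations. -/
theorem duality_of_ext_eq_sum_dirac (hadm : D.SplineAdmissible) (hpos : D.PosDef)
    {ι : Type*} [Fintype ι] {f φ : Module.Dual ℂ (Schw d)} {α : ι → ℂ} {r : ι → Sph d}
    (hf : D.ext f = ∑ n, α n • dirac (r n)) {η : C(Sph d, ℂ)} (hη : φ = D.ext (ofCont η)) :
    D.duality f φ = ∑ n, α n * η (r n) := by
  have h := duality_eq (T := ∑ n, α n • ContinuousMap.evalCLM ℂ (r n)) hadm hpos (f := f)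
    (fun h => by rw [hf, sum_dirac_apply]; simp [toCont]) hη
  simpa using h

theorem sensing_eq (hadm : D.SplineAdmissible) (hpos : D.PosDef) {L : ℕ}
    {φ : Fin L → Module.Dual ℂ (Schw d)} {l : Fin L} {η : C(Sph d, ℂ)}
    (hη : φ l = D.ext (ofCont η)) (n : Fin N) : D.sensing φ r l n = η (r n) := by
  have h := duality_of_ext_eq_sum_dirac (ι := Unit) (α := fun _ => 1) (r := fun _ => r n)
    hadm hpos (f := ofL2 (D.greenL2 (r n))) (by simp [ext_ofL2_greenL2 hadm hpos]) hη
  rw [sensing, Matrix.of_apply]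
  simpa using h

theorem sampling_synthesis (hadm : D.SplineAdmissible) (hpos : D.PosDef) {L : ℕ}
    {φ : Fin L → Module.Dual ℂ (Schw d)} (hφ : ∀ l, φ l ∈ D.predual)
    (x : EuclideanSpace ℂ (Fin N)) :
    D.sampling φ (ofL2 (D.synthesis r x : Lp ℂ 2 (surf d)))
      = (D.sensing φ r).mulVec fun n => x n := by
  ext l
  obtain ⟨-, η, hη⟩ := hφ l
  rw [sampling, duality_of_ext_eq_sum_dirac hadm hpos (ext_ofL2_synthesis hadm hpos x) hη,
    Matrix.mulVec, dotProduct]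
  exact Finset.sum_congr rfl fun n _ => by rw [sensing_eq hadm hpos hη, mul_comm]

/-- The objectives of the two problems agree under `Ψ`. -/
theorem fpbpCost_synthesis (hadm : D.SplineAdmissible) (hpos : D.PosDef)
    (hr : Function.Injective r) {L : ℕ} {φ : Fin L → Module.Dual ℂ (Schw d)}
    (hφ : ∀ l, φ l ∈ D.predual) (Fy : (Fin L → ℂ) → ℝ≥0∞) {lam : ℝ} (hlam : 0 < lam)
    (x : EuclideanSpace ℂ (Fin N)) :
    D.fpbpCost φ Fy lam (ofL2 (D.synthesis r x : Lp ℂ 2 (surf d)))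
      = pbpCost (D.sensing φ r) Fy lam x := by
  rw [fpbpCost, pbpCost, sampling_synthesis hadm hpos hφ, ext_ofL2_synthesis hadm hpos,
    tvNorm_sum_dirac hr, ENNReal.ofReal_mul hlam.le,
    ENNReal.ofReal_sum_of_nonneg fun n _ => norm_nonneg _]
  simp only [ofReal_norm]

theorem continuous_sphConv_green (hadm : D.SplineAdmissible) (hpos : D.PosDef)
    (g : Lp ℂ 2 (surf d)) : Continuous (sphConv D.green g) := by
  obtain ⟨C, hC⟩ := exists_norm_trace_le hadm hpos
  have hg : Integrable g (surf d) := (Lp.memLp g).integrable (by norm_num)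
  change Continuous fun r => ∫ s, D.trace s r * g s ∂(surf d)
  refine continuous_of_dominated (bound := fun s => C * ‖g s‖) (fun r => ?_)
    (fun r => Eventually.of_forall fun s => ?_) (hg.norm.const_mul C)
    (Eventually.of_forall fun s => ?_)
  · have : Continuous fun s => D.trace s r :=
      (continuous_trace_uncurry hadm hpos).uncurry_right r
    exact this.aestronglyMeasurable.mul hg.1
  · rw [norm_mul]
    exact mul_le_mul_of_nonneg_right (hC s r) (norm_nonneg _)
  · have := continuous_trace hadm hpos s
    fun_prop

/-- A square-integrable function is the image under `D` of its convolution with the Green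
kernel. -/
theorem ext_ofCont_sphConv_green (hadm : D.SplineAdmissible) (hpos : D.PosDef)
    (g : Lp ℂ 2 (surf d)) :
    ofL2 g = D.ext (ofCont ⟨sphConv D.green g, continuous_sphConv_green hadm hpos g⟩) := by
  obtain ⟨C, hC⟩ := exists_norm_trace_le hadm hpos
  have hg : Integrable g (surf d) := (Lp.memLp g).integrable (by norm_num)
  ext h
  have hint : Integrable (fun p : Sph d × Sph d =>
      D.trace p.2 p.1 * ((D.toLin h : Sph d → ℂ) p.1 * g p.2)) ((surf d).prod (surf d)) := by
    refine ((integrable_of_continuous (schw_continuous (D.toLin h))).mul_prod hg).bdd_mul (c := C)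
      ?_ (Eventually.of_forall fun p => hC p.2 p.1)
    exact ((continuous_trace_uncurry hadm hpos).comp continuous_swap).aestronglyMeasurable
  change ∫ s, g s * (h : Sph d → ℂ) s ∂(surf d)
    = ∫ r, (∫ s, D.trace s r * g s ∂(surf d)) * (D.toLin h : Sph d → ℂ) r ∂(surf d)
  calc ∫ s, g s * (h : Sph d → ℂ) s ∂(surf d)
      = ∫ s, ∫ r, D.trace s r * ((D.toLin h : Sph d → ℂ) r * g s) ∂(surf d) ∂(surf d) := by
        refine integral_congr_ae (Eventually.of_forall fun s => ?_)
        simp only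
        rw [← integral_trace_mul_toLin hadm hpos h s, ← integral_const_mul]
        congr 1; ext r; ring
    _ = ∫ r, ∫ s, D.trace s r * ((D.toLin h : Sph d → ℂ) r * g s) ∂(surf d) ∂(surf d) :=
        (integral_integral_swap hint).symm
    _ = _ := by
        refine integral_congr_ae (Eventually.of_forall fun r => ?_)
        simp only
        rw [← integral_mul_const]
        congr 1; ext s; ring

theorem sensing_eq_sphConv (hadm : D.SplineAdmissible) (hpos : D.PosDef) {L : ℕ}
    {φ : Fin L → Module.Dual ℂ (Schw d)} {l : Fin L} {g : Lp ℂ 2 (surf d)} (hg : φ l = ofL2 g)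
    (n : Fin N) : D.sensing φ r l n = sphConv D.green g (r n) :=
  sensing_eq hadm hpos (hg.trans (ext_ofCont_sphConv_green hadm hpos g)) n

end PseudoDiffOp

/-! ### Optimisation -/

/-- A bijection that preserves the objective maps minimisers to minimisers bijectively. -/
theorem bijOn_argMin {X Y : Type*} {A : X → Y} (hA : Function.Bijective A) {J : Y → ℝ≥0∞}
    {K : X → ℝ≥0∞} (hJK : ∀ x, J (A x) = K x) : Set.BijOn A (argMin K) (argMin J) := by
  refine ⟨fun x hx y => ?_, hA.1.injOn, fun y hy => ?_⟩
  · obtain ⟨z, rfl⟩ := hA.2 y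
    rw [hJK, hJK]
    exact hx z
  · obtain ⟨x, rfl⟩ := hA.2 y
    exact ⟨x, fun z => by rw [← hJK, ← hJK]; exact hy (A z), rfl⟩

theorem isMoorePenrose_symm {E F : Type*} [NormedAddCommGroup E] [InnerProductSpace ℂ E]
    [NormedAddCommGroup F] [InnerProductSpace ℂ F] (e : E ≃ₗ[ℂ] F) :
    IsMoorePenrose (e : E →ₗ[ℂ] F) (e.symm : F →ₗ[ℂ] E) where
  aba := by ext; simp
  bab := by ext; simp
  symm_ab := fun x y => by simp
  symm_ba := fun x y => by simp

end

end SphereSpline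

open SphereSpline
theorem theorem3 {d : ℕ} [Fact (2 ≤ d)] (D : PseudoDiffOp d)
    (hadm : D.SplineAdmissible) (hpos : D.PosDef)
    {L : ℕ} (φ : Fin L → Module.Dual ℂ (Schw d)) (hφ : ∀ l, φ l ∈ D.predual)
    (hli : LinearIndependent ℂ φ)
    (F : (Fin L → ℂ) → (Fin L → ℂ) → ℝ≥0∞) (hF : ∀ y, IsCost (F y))
    (lam : ℝ) (hlam : 0 < lam)
    {N : ℕ} (r : Fin N → Sph d) (hr : Function.Injective r) :
    -- the zonal functions are square-integrable, their span is the space of splines with the given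
    -- knots, and it is contained in the search space
    (∀ n, MemLp (D.trace (r n)) 2 (surf d)) ∧
    ofL2 '' (D.splineSpan r : Set (Lp ℂ 2 (surf d))) = D.splines r ∧
    D.splines r ⊆ D.searchSpace ∧
    -- the two problems are equivalent
    (∀ (y : Fin L → ℂ) (V : Set (D.splineSpan r)) (U : Set (EuclideanSpace ℂ (Fin N))),
      V = argMin (fun f : D.splineSpan r => D.fpbpCost φ (F y) lam (ofL2 (f : Lp ℂ 2 (surf d)))) →
      U = argMin (pbpCost (D.sensing φ r) (F y) lam) →
      Set.BijOn (D.synthesis r) U V ∧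
      V = D.synthesis r '' U ∧
      ∃ Ψd : D.splineSpan r →ₗ[ℂ] EuclideanSpace ℂ (Fin N),
        IsMoorePenrose (D.synthesis r) Ψd ∧ U = Ψd '' V) ∧
    -- the matrix `G` represents `Φ Ψ`
    (∀ x : EuclideanSpace ℂ (Fin N),
      D.sampling φ (ofL2 (D.synthesis r x : Lp ℂ 2 (surf d)))
        = (D.sensing φ r).mulVec fun n => x n) ∧
    -- and its entries are convolutions when the sampling functionals are square-integrable
    (∀ (l : Fin L) (g : Lp ℂ 2 (surf d)), φ l = ofL2 g →
      ∀ n, D.sensing φ r l n = sphConv D.green g (r n)) := by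
  have hbij := PseudoDiffOp.synthesis_bijective (r := r) hadm hpos hr
  refine ⟨fun n => PseudoDiffOp.memLp_trace hadm hpos (r n),
    PseudoDiffOp.image_ofL2_splineSpan hadm hpos hr,
    PseudoDiffOp.splines_subset_searchSpace hr, ?_,
    fun x => PseudoDiffOp.sampling_synthesis hadm hpos hφ x,
    fun l g hg n => PseudoDiffOp.sensing_eq_sphConv hadm hpos hg n⟩
  rintro y V U rfl rfl
  have hon := bijOn_argMin hbij
    (J := fun f : D.splineSpan r => D.fpbpCost φ (F y) lam (ofL2 (f : Lp ℂ 2 (surf d))))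
    (fun x => PseudoDiffOp.fpbpCost_synthesis hadm hpos hr hφ (F y) hlam x)
  refine ⟨hon, hon.image_eq.symm, _,
    isMoorePenrose_symm (LinearEquiv.ofBijective (D.synthesis r) hbij), ?_⟩
  rw [← hon.image_eq, ← Set.image_comp]
  have hid : ∀ x, (LinearEquiv.ofBijective (D.synthesis r) hbij).symm (D.synthesis r x) = x :=
    (LinearEquiv.ofBijective (D.synthesis r) hbij).symm_apply_apply
  exact ((Set.image_congr fun x _ => hid x).trans (Set.image_id' _)).symm
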